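/- Let $1<p<\infty$ and $q=p/(p-1)$. For $\alpha>-1$ let $dA_\alpha(z)=(1+\alpha)(1-|z|^2)^\alpha\,\frac{dx\,dy}{\pi}$ on the open unit disk $\mathbb D$, let $L^p_\alpha=L^p(\mathbb D,dA_\alpha)$ with norm $\|\cdot\|_{p,\alpha}$, and let $$P_\alpha f(z)=\int_{\mathbb D}\frac{f(w)}{(1-z\bar w)^{2+\alpha}}\,dA_\alpha(w),\qquad z\in\mathbb D,$$ be the weighted Bergman projection. Then for every $\alpha>-1$ and $f\in L^p_\alpha$ this integral converges absolutely for every $z\in\mathbb D$ and $P_\alpha f\in L^p_\alpha$, and the operator norm $\|P_\alpha\|_{p,\alpha}=\sup\{\|P_\alpha f\|_{p,\alpha}/\|f\|_{p,\alpha} : f\in L^p_\alpha,\ f\neq 0\}$ satisfies $$\frac{\Gamma\left(\frac{2+\alpha}{p}\right)\Gamma\left(\frac{2+\alpha}{q}\right)}{\Gamma^2\left(\frac{2+\alpha}{2}\right)}\le\|P_\alpha\|_{p,\alpha}\le(1+\alpha)\,\frac{\Gamma\left(\frac{1+\alpha}{p}\right)\Gamma\left(\frac{1+\alpha}{q}\right)}{\Gamma^2\left(\frac{2+\alpha}{2}\right)}.$$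 Moreover, as $\alpha\to-1^+$ with $p$ fixed, the lower bound tends to $\csc(\pi/p)=1/\sin(\pi/p)$. -/

import Mathlib

open MeasureTheory Filter Topology

noncomputable section

/-- The standard weighted area measure `dA_α(z) = (1 + α) (1 - |z|²)^α dA(z)` on the open unit disk
(as a measure on `ℂ` carried by the disk), where `dA = π⁻¹ dx dy`. -/
def diskMeasure (α : ℝ) : Measure ℂ :=
  (volume.restrict (Metric.ball (0 : ℂ) 1)).withDensity
    (fun z => ENNReal.ofReal ((1 + α) * (1 - ‖z‖ ^ 2) ^ α * Real.pi⁻¹))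

/-- The integrand `f(w) / (1 - z w̄)^(2 + α)`; for `z, w` in the disk `1 - z w̄` has positive real
part and the power is the principal one. -/
def bergmanIntegrand (α : ℝ) (f : ℂ → ℂ) (z w : ℂ) : ℂ :=
  f w / (1 - z * (starRingEnd ℂ) w) ^ ((2 + α : ℝ) : ℂ)

/-- The weighted Bergman projection
`P_α f(z) = ∫ f(w) / (1 - z w̄)^(2 + α) dA_α(w)`, for `z` in the disk. -/
def bergmanProj (α : ℝ) (f : ℂ → ℂ) (z : ℂ) : ℂ :=
  ∫ w, bergmanIntegrand α f z w ∂(diskMeasure α)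

/-- The operator norm of `P_α` on `L^p_α`: the supremum, in `[0, ∞]`, of
`‖P_α f‖_{p,α} / ‖f‖_{p,α}` over all nonzero `f ∈ L^p_α`. -/
def bergmanNorm (p α : ℝ) : ENNReal :=
  ⨆ (f : ℂ → ℂ) (_ : MemLp f (ENNReal.ofReal p) (diskMeasure α))
    (_ : ¬ f =ᵐ[diskMeasure α] 0),
    eLpNorm (bergmanProj α f) (ENNReal.ofReal p) (diskMeasure α) /
      eLpNorm f (ENNReal.ofReal p) (diskMeasure α)

end

/-! Upper bound. The kernel modulus |1 - z w̄|^(-(2+α)) is the squared modulus of a binomial series.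
Orthogonality of the monomials therefore turns its integral against (1-|w|²)^(-b) dA_α(w) into a
power series in |z|². Log-convexity of Γ dominates this series, coefficient by coefficient, by a
constant times that of (1-|z|²)^(-b) (`integral_absKernel_le`). Schur's test
(`lintegral_rpow_le_of_schur`) with a power of 1-|w|² as test function then bounds even the operator
whose kernel is the modulus.

Lower bound. Put A = 2 + α and pair P f with g, where f = (1-ρw)^(-a) conj((1-ρw)^(-b)) and g has -b
in place of b. For b = 2a/p - a one has |f|^p = |g|^q = |1-ρw|^(-2a), so the product of the norms is
the integral of this one function. Let ρ → 1 with a < A/2. The integral stays below ∑ x_n, where x_n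
= (a)_n² / (n! (A)_n), and the terms of the pairing tend to x_n R_n with R = `pairingRatio`; thus ∑
x_n R_n ≤ ‖P‖ ∑ x_n (`sum_pairingRatio_le`). The ratios R_n increase with n, and at a = A/2 the
series ∑ x_n diverges, so as a → A/2 the weight escapes to large n and R_k ≤ ‖P‖ for every k at a =
A/2 (`pairingRatio_le_of_bergmanNorm_le`). The limit of R_k is the claimed bound. -/

/-! ### Binomial coefficients and their generating series -/

/-- The coefficient `(a)_n / n!` of `z ^ n` in the binomial series of `(1 - z) ^ (-a)`. -/
noncomputable def negBinom (a : ℝ) (n : ℕ) : ℝ := ∏ i ∈ Finset.range n, (a + i) / (i + 1)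

theorem negBinom_zero (a : ℝ) : negBinom a 0 = 1 := by simp [negBinom]

theorem negBinom_succ (a : ℝ) (n : ℕ) :
    negBinom a (n + 1) = negBinom a n * ((a + n) / (n + 1)) := by
  rw [negBinom, Finset.prod_range_succ, negBinom]

theorem negBinom_pos {a : ℝ} (ha : 0 < a) (n : ℕ) : 0 < negBinom a n :=
  Finset.prod_pos fun i _ => by positivity

theorem abs_negBinom_le (a : ℝ) (n : ℕ) : |negBinom a n| ≤ negBinom |a| n := by
  rw [negBinom, negBinom, Finset.abs_prod]
  refine Finset.prod_le_prod (fun _ _ => abs_nonneg _) fun i _ => ?_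
  rw [abs_div, abs_of_pos (by positivity : (0 : ℝ) < i + 1)]
  gcongr
  exact (abs_add_le _ _).trans (by simp)

theorem negBinom_mono {a b : ℝ} (ha : 0 ≤ a) (hab : a ≤ b) (n : ℕ) :
    negBinom a n ≤ negBinom b n :=
  Finset.prod_le_prod (fun i _ => by positivity) fun i _ => by gcongr

theorem continuous_negBinom (n : ℕ) : Continuous fun a => negBinom a n := by
  unfold negBinom
  fun_prop

theorem negBinom_eq_choose (a : ℝ) (n : ℕ) :
    (negBinom a n : ℂ) = Ring.choose ((a : ℂ) + n - 1) n := by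
  have h : Ring.choose ((a : ℂ) + n - 1) n = Ring.multichoose (a : ℂ) n := by
    rw [Ring.choose]; congr 1; ring
  have h2 := Ring.factorial_nsmul_multichoose_eq_ascPochhammer (a : ℂ) n
  rw [Polynomial.ascPochhammer_smeval_eq_eval] at h2
  rw [h]
  have h3 : ((n.factorial : ℕ) : ℂ) ≠ 0 := by exact_mod_cast n.factorial_ne_zero
  apply mul_left_cancel₀ h3
  rw [← nsmul_eq_mul, ← nsmul_eq_mul, h2, nsmul_eq_mul]
  clear h h2 h3
  induction n with
  | zero => simp [negBinom]
  | succ n ih =>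
    rw [negBinom_succ, ascPochhammer_succ_eval, ← ih, Nat.factorial_succ]
    have : ((n : ℂ) + 1) ≠ 0 := by exact_mod_cast n.succ_ne_zero
    push_cast
    field_simp

theorem hasSum_negBinom (a : ℝ) {z : ℂ} (hz : ‖z‖ < 1) :
    HasSum (fun n => (negBinom a n : ℂ) * z ^ n) ((1 - z) ^ (-(a : ℂ))) := by
  have h := (Complex.one_div_one_sub_cpow_hasFPowerSeriesOnBall_zero (a : ℂ)).hasSum (y := z)
    (by simpa [enorm_eq_nnnorm, ← NNReal.coe_lt_coe] using hz)
  simp only [zero_add, one_div, FormalMultilinearSeries.ofScalars_apply_eq, smul_eq_mul,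
    ← negBinom_eq_choose] at h
  rwa [Complex.cpow_neg]

theorem hasSum_negBinom_real (a : ℝ) {x : ℝ} (hx : |x| < 1) :
    HasSum (fun n => negBinom a n * x ^ n) ((1 - x) ^ (-a)) := by
  have h := hasSum_negBinom a (z := (x : ℂ)) (by simpa using hx)
  rw [← Complex.ofReal_one, ← Complex.ofReal_sub, ← Complex.ofReal_neg,
    ← Complex.ofReal_cpow (by linarith [(abs_lt.1 hx).2])] at h
  exact_mod_cast h

theorem summable_negBinom {a r : ℝ} (hr0 : 0 ≤ r) (hr : r < 1) :
    Summable fun n => |negBinom a n| * r ^ n :=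
  .of_nonneg_of_le (fun _ => by positivity) (fun n => by gcongr; exact abs_negBinom_le a n)
    (hasSum_negBinom_real |a| (by rwa [abs_of_nonneg hr0])).summable

/-! ### Gamma quotients and beta integrals -/

theorem Gamma_add_nat {a : ℝ} (ha : 0 < a) (n : ℕ) :
    Real.Gamma (a + n) = Real.Gamma a * n.factorial * negBinom a n := by
  induction n with
  | zero => simp [negBinom]
  | succ n ih =>
    push_cast [Nat.factorial_succ]
    rw [← add_assoc, Real.Gamma_add_one (by positivity), ih, negBinom_succ]
    field_simp

theorem integrableOn_beta {a b : ℝ} (ha : 0 < a) (hb : 0 < b) :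
    IntegrableOn (fun t : ℝ => t ^ (a - 1) * (1 - t) ^ (b - 1)) (Set.Ioo 0 1) := by
  have h := Complex.betaIntegral_convergent (u := a) (v := b) (by simpa) (by simpa)
  rw [intervalIntegrable_iff_integrableOn_Ioo_of_le zero_le_one] at h
  refine IntegrableOn.congr_fun (Integrable.re h) (fun t ht => ?_) measurableSet_Ioo
  simp only [RCLike.re_to_complex]
  rw [← Complex.ofReal_one, ← Complex.ofReal_sub, ← Complex.ofReal_sub, ← Complex.ofReal_sub,
    ← Complex.ofReal_cpow ht.1.le, ← Complex.ofReal_cpow (by linarith [ht.2]),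
    ← Complex.ofReal_mul, Complex.ofReal_re]

theorem integral_beta {a b : ℝ} (ha : 0 < a) (hb : 0 < b) :
    ∫ t in Set.Ioo (0 : ℝ) 1, t ^ (a - 1) * (1 - t) ^ (b - 1) =
      Real.Gamma a * Real.Gamma b / Real.Gamma (a + b) := by
  have h := Complex.betaIntegral_eq_Gamma_mul_div (a : ℂ) b (by simpa) (by simpa)
  rw [Complex.betaIntegral, intervalIntegral.integral_of_le zero_le_one] at h
  rw [← Complex.ofReal_inj, ← integral_complex_ofReal, ← integral_Ioc_eq_integral_Ioo]
  simp only [Complex.ofReal_div, Complex.ofReal_mul, ← Complex.Gamma_ofReal, Complex.ofReal_add]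
  rw [← h, integral_Ioc_eq_integral_Ioo, integral_Ioc_eq_integral_Ioo]
  refine setIntegral_congr_fun measurableSet_Ioo fun t ht => ?_
  rw [Complex.ofReal_cpow ht.1.le, Complex.ofReal_cpow (by linarith [ht.2])]
  push_cast
  rfl

theorem Gamma_sq_le {x y z : ℝ} (hx : 0 < x) (hy : 0 < y) (h : 2 * z = x + y) :
    Real.Gamma z ^ 2 ≤ Real.Gamma x * Real.Gamma y := by
  have h1 := Real.Gamma_mul_add_mul_le_rpow_Gamma_mul_rpow_Gamma hx hy (a := 1 / 2) (b := 1 / 2)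
    (by norm_num) (by norm_num) (by norm_num)
  rw [show 1 / 2 * x + 1 / 2 * y = z by linarith, ← Real.sqrt_eq_rpow, ← Real.sqrt_eq_rpow,
    ← Real.sqrt_mul (Real.Gamma_pos_of_pos hx).le] at h1
  have h2 := Real.Gamma_pos_of_pos hx
  have h3 := Real.Gamma_pos_of_pos hy
  exact (Real.le_sqrt (Real.Gamma_pos_of_pos (by linarith)).le (by positivity)).1 h1

theorem negBinom_ratio_eq_integral {a A : ℝ} (ha : 0 < a) (haA : a < A) (n : ℕ) :
    negBinom a n / negBinom A n = Real.Gamma A / (Real.Gamma a * Real.Gamma (A - a)) *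
      ∫ t in Set.Ioo (0 : ℝ) 1, t ^ (a + n - 1) * (1 - t) ^ (A - a - 1) := by
  rw [integral_beta (by positivity) (by linarith), show a + n + (A - a) = A + n by ring,
    Gamma_add_nat ha, Gamma_add_nat (ha.trans haA)]
  have h1 := Real.Gamma_pos_of_pos ha
  have h2 := Real.Gamma_pos_of_pos (ha.trans haA)
  have h3 := Real.Gamma_pos_of_pos (sub_pos.2 haA)
  have h4 := negBinom_pos (ha.trans haA) n
  field_simp

/-- Euler's limit for Γ: the powers of n cancel because (A - b) + (A + b) = 2A. -/
theorem tendsto_negBinom_ratio {A b : ℝ} (hA : 0 < A) (hb : |b| < A) :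
    Tendsto (fun n => negBinom A n ^ 2 / (negBinom (A - b) n * negBinom (A + b) n)) atTop
      (𝓝 (Real.Gamma (A - b) * Real.Gamma (A + b) / Real.Gamma A ^ 2)) := by
  obtain ⟨hb1, hb2⟩ := abs_lt.1 hb
  -- `Real.GammaSeq s n` has n + 1 factors in its denominator, so it matches `negBinom s (n + 1)`.
  rw [← tendsto_add_atTop_iff_nat 1]
  refine (((Real.GammaSeq_tendsto_Gamma (A - b)).mul (Real.GammaSeq_tendsto_Gamma (A + b))).div
    ((Real.GammaSeq_tendsto_Gamma A).pow 2) (by have := Real.Gamma_pos_of_pos hA; positivity)).congr'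
    ?_
  filter_upwards [eventually_gt_atTop 0] with n hn
  have hn' : (0 : ℝ) < n := by exact_mod_cast hn
  have key : ∀ s : ℝ, 0 < s →
      Real.GammaSeq s n = n ^ s * n.factorial / ((n + 1).factorial * negBinom s (n + 1)) := by
    intro s hs
    have h : (∏ i ∈ Finset.range (n + 1), ((i : ℝ) + 1)) = (n + 1).factorial := by
      rw [← Finset.prod_range_add_one_eq_factorial]; push_cast; rfl
    rw [Real.GammaSeq, negBinom, Finset.prod_div_distrib, h, mul_div_cancel₀]
    positivity
  simp only [Pi.div_apply]
  rw [key _ (by linarith), key _ (by linarith), key _ hA]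
  have h1 := negBinom_pos hA (n + 1)
  have h2 := negBinom_pos (a := A - b) (by linarith) (n + 1)
  have h3 := negBinom_pos (a := A + b) (by linarith) (n + 1)
  have h4 : (n : ℝ) ^ (A - b) * (n : ℝ) ^ (A + b) = (n ^ A) ^ 2 := by
    rw [← Real.rpow_add hn', ← Real.rpow_mul_natCast hn'.le]; congr 1; push_cast; ring
  have h5 : 0 < (n : ℝ) ^ A := by positivity
  field_simp
  rw [← h4]

theorem negBinom_ratio_mono {A b : ℝ} (hA : 0 < A) (hb : |b| < A) :
    Monotone fun n => negBinom A n ^ 2 / (negBinom (A - b) n * negBinom (A + b) n) := by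
  obtain ⟨hb1, hb2⟩ := abs_lt.1 hb
  refine monotone_nat_of_le_succ fun n => ?_
  have h1 := negBinom_pos hA n
  have h2 := negBinom_pos (a := A - b) (by linarith) n
  have h3 := negBinom_pos (a := A + b) (by linarith) n
  have hn : (0 : ℝ) ≤ n := n.cast_nonneg
  have e1 : 0 < A - b + n := by linarith
  have e2 : 0 < A + b + n := by linarith
  rw [negBinom_succ, negBinom_succ, negBinom_succ, div_le_div_iff₀ (by positivity) (by positivity)]
  have h4 : (A - b + n) * (A + b + n) ≤ (A + n) ^ 2 := by nlinarith [sq_nonneg b]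
  calc _ = negBinom A n ^ 2 * negBinom (A - b) n * negBinom (A + b) n / (n + 1) ^ 2 *
        ((A - b + n) * (A + b + n)) := by field_simp
    _ ≤ negBinom A n ^ 2 * negBinom (A - b) n * negBinom (A + b) n / (n + 1) ^ 2 * (A + n) ^ 2 := by
        gcongr
    _ = _ := by field_simp

/-! ### The weighted measure and orthogonality of monomials -/

theorem measurable_diskDensity (β : ℝ) :
    Measurable fun z : ℂ => (1 + β) * (1 - ‖z‖ ^ 2) ^ β * Real.pi⁻¹ := by
  fun_prop

theorem diskDensity_nonneg {β : ℝ} (hβ : -1 < β) {z : ℂ} (hz : z ∈ Metric.ball (0 : ℂ) 1) :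
    0 ≤ (1 + β) * (1 - ‖z‖ ^ 2) ^ β * Real.pi⁻¹ := by
  have : ‖z‖ < 1 := by simpa using hz
  have h1 : 0 ≤ 1 - ‖z‖ ^ 2 := by nlinarith [norm_nonneg z]
  have h2 : 0 ≤ 1 + β := by linarith
  positivity

theorem ae_diskMeasure_mem_ball (β : ℝ) : ∀ᵐ z ∂(diskMeasure β), z ∈ Metric.ball (0 : ℂ) 1 :=
  (withDensity_absolutelyContinuous _ _).ae_le (ae_restrict_mem Metric.isOpen_ball.measurableSet)

theorem integral_diskMeasure {β : ℝ} (hβ : -1 < β) (F : ℂ → ℂ) :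
    ∫ z, F z ∂(diskMeasure β) =
      ∫ z in Metric.ball (0 : ℂ) 1, ((1 + β) * (1 - ‖z‖ ^ 2) ^ β * Real.pi⁻¹ : ℝ) * F z := by
  rw [diskMeasure, integral_withDensity_eq_integral_toReal_smul
    (measurable_diskDensity β).ennreal_ofReal (ae_of_all _ fun _ => ENNReal.ofReal_lt_top)]
  refine setIntegral_congr_fun Metric.isOpen_ball.measurableSet fun z hz => ?_
  simp only [ENNReal.toReal_ofReal (diskDensity_nonneg hβ hz), Complex.real_smul]

/-- The substitution t = r² gives a beta integral; the indicator lets it be done on the whole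
half-line. -/
theorem integral_radial {β : ℝ} (hβ : -1 < β) (n : ℕ) :
    ∫ r in Set.Ioi (0 : ℝ), (Set.Iio (1 : ℝ)).indicator
      (fun r => 2 * (1 + β) * r ^ (2 * n + 1) * (1 - r ^ 2) ^ β) r =
      (negBinom (β + 2) n)⁻¹ := by
  have h := integral_comp_rpow_Ioi
    (fun t : ℝ => (Set.Iio (1 : ℝ)).indicator (fun t => t ^ (n : ℝ) * (1 - t) ^ β) t) (p := 2)
    (by norm_num)
  have hB := integral_beta (a := n + 1) (b := β + 1) (by positivity) (by linarith)
  rw [setIntegral_indicator measurableSet_Iio, Set.Ioi_inter_Iio] at h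
  simp only [add_sub_cancel_right] at hB
  rw [hB] at h
  have e : ∀ r ∈ Set.Ioi (0 : ℝ), (Set.Iio (1 : ℝ)).indicator
      (fun r => 2 * (1 + β) * r ^ (2 * n + 1) * (1 - r ^ 2) ^ β) r = (1 + β) *
      ((|2| * r ^ ((2 : ℝ) - 1)) • (Set.Iio (1 : ℝ)).indicator
        (fun t => t ^ (n : ℝ) * (1 - t) ^ β) (r ^ (2 : ℝ))) := by
    intro r hr
    have hr : 0 < r := hr
    have e1 : r ^ (2 : ℝ) = r ^ 2 := by norm_cast
    have e2 : r ^ ((2 : ℝ) - 1) = r := by norm_num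
    rw [e1, e2]
    by_cases h1 : r < 1
    · rw [Set.indicator_of_mem (by simpa using h1),
        Set.indicator_of_mem (by simp only [Set.mem_Iio]; nlinarith)]
      simp only [abs_two, Real.rpow_natCast, smul_eq_mul]
      ring
    · rw [Set.indicator_of_notMem (by simpa using h1),
        Set.indicator_of_notMem (by simp only [Set.mem_Iio]; nlinarith)]
      simp
  rw [setIntegral_congr_fun measurableSet_Ioi e, integral_const_mul, h,
    show (n : ℝ) + 1 + (β + 1) = β + 2 + n by ring, Gamma_add_nat (by linarith),
    Real.Gamma_nat_eq_factorial, show β + 2 = β + 1 + 1 by ring,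
    Real.Gamma_add_one (s := β + 1) (by linarith)]
  have h1 := Real.Gamma_pos_of_pos (s := β + 1) (by linarith)
  have h2 := negBinom_pos (a := β + 1 + 1) (by linarith) n
  have h3 : 0 < β + 1 := by linarith
  rw [add_comm 1 β]
  field_simp

theorem integral_exp_angle (k : ℤ) :
    ∫ θ in Set.Ioo (-Real.pi) Real.pi, Complex.exp (k * θ * Complex.I) =
      if k = 0 then 2 * (Real.pi : ℂ) else 0 := by
  rw [← integral_Ioc_eq_integral_Ioo,
    ← intervalIntegral.integral_of_le (by linarith [Real.pi_pos])]
  split_ifs with h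
  · subst h
    simp
    ring
  · have h' : (k * Complex.I : ℂ) ≠ 0 := by simp [h]
    have := integral_exp_mul_complex (a := -Real.pi) (b := Real.pi) h'
    simp_rw [show ∀ θ : ℝ, (k : ℂ) * θ * Complex.I = k * Complex.I * θ from fun θ => by ring]
    rw [this, div_eq_zero_iff]
    left
    rw [sub_eq_zero, Complex.exp_eq_exp_iff_exists_int]
    exact ⟨k, by push_cast; ring⟩

theorem integral_monomial {β : ℝ} (hβ : -1 < β) (j l : ℕ) :
    ∫ w, w ^ j * (starRingEnd ℂ) w ^ l ∂(diskMeasure β) =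
      if j = l then ((negBinom (β + 2) j)⁻¹ : ℂ) else 0 := by
  rw [integral_diskMeasure hβ, ← integral_indicator Metric.isOpen_ball.measurableSet,
    ← Complex.integral_comp_polarCoord_symm, polarCoord_target]
  have e : ∀ p ∈ Set.Ioi (0 : ℝ) ×ˢ Set.Ioo (-Real.pi) Real.pi,
      p.1 • (Metric.ball (0 : ℂ) 1).indicator (fun z : ℂ =>
        ((1 + β) * (1 - ‖z‖ ^ 2) ^ β * Real.pi⁻¹ : ℝ) * (z ^ j * (starRingEnd ℂ) z ^ l))
        (Complex.polarCoord.symm p) =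
      (((Set.Iio (1 : ℝ)).indicator
        (fun r => (1 + β) * Real.pi⁻¹ * r ^ (j + l + 1) * (1 - r ^ 2) ^ β) p.1 : ℝ) : ℂ) *
      Complex.exp (((j : ℤ) - l : ℤ) * p.2 * Complex.I) := by
    rintro ⟨r, θ⟩ ⟨hr, -⟩
    have hr : 0 < r := hr
    have hz : Complex.polarCoord.symm (r, θ) = r * Complex.exp (θ * Complex.I) := by
      rw [Complex.polarCoord_symm_apply, Complex.exp_mul_I]; simp
    have hn : ‖(r : ℂ) * Complex.exp (θ * Complex.I)‖ = r := by
      simp [Complex.norm_exp_ofReal_mul_I, abs_of_pos hr]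
    rw [hz]
    by_cases h1 : r < 1
    · rw [Set.indicator_of_mem (by rwa [mem_ball_zero_iff, hn]),
        Set.indicator_of_mem (by simpa using h1),
        hn]
      have hc : (starRingEnd ℂ) ((r : ℂ) * Complex.exp (θ * Complex.I)) =
          r * Complex.exp (-(θ * Complex.I)) := by
        rw [map_mul, Complex.conj_ofReal, ← Complex.exp_conj]; simp
      rw [hc, mul_pow, mul_pow, ← Complex.exp_nat_mul, ← Complex.exp_nat_mul]
      have : Complex.exp (((j : ℤ) - l : ℤ) * θ * Complex.I) =
          Complex.exp (j * (θ * Complex.I)) * Complex.exp (l * -(θ * Complex.I)) := by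
        rw [← Complex.exp_add]; congr 1; push_cast; ring
      simp only [this, Complex.real_smul]
      push_cast
      ring
    · rw [Set.indicator_of_notMem (by rwa [mem_ball_zero_iff, hn]),
        Set.indicator_of_notMem (by simpa using h1)]
      simp
  rw [setIntegral_congr_fun (measurableSet_Ioi.prod measurableSet_Ioo) e, Measure.volume_eq_prod,
    setIntegral_prod_mul (fun r : ℝ => (((Set.Iio (1 : ℝ)).indicator
        (fun r => (1 + β) * Real.pi⁻¹ * r ^ (j + l + 1) * (1 - r ^ 2) ^ β) r : ℝ) : ℂ))
      (fun θ : ℝ => Complex.exp (((j : ℤ) - l : ℤ) * θ * Complex.I)), integral_exp_angle]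
  by_cases hjl : j = l
  · subst hjl
    simp only [sub_self, if_true]
    rw [← Complex.ofReal_inv, ← integral_radial hβ, integral_complex_ofReal]
    norm_cast
    rw [← integral_mul_const]
    refine integral_congr_ae (ae_of_all _ fun r => ?_)
    by_cases h1 : r < 1
    · simp only [Set.mem_Iio, h1, Set.indicator_of_mem]
      have := Real.pi_ne_zero
      field_simp
      ring_nf
    · simp [h1]
  · rw [if_neg hjl, if_neg (by omega), mul_zero]

theorem isProbabilityMeasure_diskMeasure {β : ℝ} (hβ : -1 < β) :
    IsProbabilityMeasure (diskMeasure β) := by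
  have h := integral_monomial hβ 0 0
  simp only [pow_zero, mul_one, if_true, negBinom_zero, integral_const, Complex.real_smul,
    Complex.ofReal_one, inv_one] at h
  have h' : (diskMeasure β).real Set.univ = 1 := by exact_mod_cast h
  exact ⟨(ENNReal.toReal_eq_one_iff _).1 h'⟩

/-- Parseval's identity. Absolute summability of the coefficients bounds the double series uniformly
on the disk, which allows termwise integration. -/
theorem hasSum_integral_mul_conj {β : ℝ} (hβ : -1 < β) {u v : ℕ → ℂ} {F G : ℂ → ℂ}
    (hu : Summable fun n => ‖u n‖) (hv : Summable fun n => ‖v n‖)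
    (hF : ∀ w ∈ Metric.ball (0 : ℂ) 1, HasSum (fun n => u n * w ^ n) (F w))
    (hG : ∀ w ∈ Metric.ball (0 : ℂ) 1, HasSum (fun n => v n * w ^ n) (G w)) :
    HasSum (fun n => u n * (starRingEnd ℂ) (v n) / negBinom (β + 2) n)
      (∫ w, F w * (starRingEnd ℂ) (G w) ∂(diskMeasure β)) := by
  have := isProbabilityMeasure_diskMeasure hβ
  let T : ℕ × ℕ → ℂ → ℂ := fun p w =>
    (u p.1 * (starRingEnd ℂ) (v p.2)) * (w ^ p.1 * (starRingEnd ℂ) w ^ p.2)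
  have hbd : ∀ p, ∀ᵐ w ∂(diskMeasure β), ‖T p w‖ ≤ ‖u p.1‖ * ‖v p.2‖ := fun p => by
    filter_upwards [ae_diskMeasure_mem_ball β] with w hw
    have hw : ‖w‖ < 1 := by simpa using hw
    simp only [T, norm_mul, norm_pow, RCLike.norm_conj]
    refine mul_le_of_le_one_right (by positivity) (mul_le_one₀ ?_ (by positivity) ?_) <;>
      exact pow_le_one₀ (norm_nonneg _) hw.le
  have hint : ∀ p, Integrable (T p) (diskMeasure β) := fun p =>
    Integrable.of_bound (by unfold T; fun_prop) _ (hbd p)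
  have hsum : Summable fun p : ℕ × ℕ => ‖u p.1‖ * ‖v p.2‖ :=
    hu.mul_of_nonneg hv (fun _ => norm_nonneg _) (fun _ => norm_nonneg _)
  have h1 := hasSum_integral_of_summable_integral_norm (F := T) hint
    (.of_nonneg_of_le (fun _ => integral_nonneg fun _ => norm_nonneg _) (fun p => by
      simpa using integral_mono_ae (hint p).norm (integrable_const _) (hbd p)) hsum)
  have h2 : ∫ w, ∑' p, T p w ∂(diskMeasure β) =
      ∫ w, F w * (starRingEnd ℂ) (G w) ∂(diskMeasure β) := by
    refine integral_congr_ae ?_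
    filter_upwards [ae_diskMeasure_mem_ball β] with w hw
    have hw' : ‖w‖ < 1 := by simpa using hw
    have s1 : Summable fun n => ‖u n * w ^ n‖ := .of_nonneg_of_le (fun _ => norm_nonneg _)
      (fun n => by
        rw [norm_mul, norm_pow]
        exact mul_le_of_le_one_right (norm_nonneg _) (pow_le_one₀ (norm_nonneg _) hw'.le)) hu
    have s2 : Summable fun n => ‖(starRingEnd ℂ) (v n * w ^ n)‖ := .of_nonneg_of_le
      (fun _ => norm_nonneg _) (fun n => by
        rw [RCLike.norm_conj, norm_mul, norm_pow]
        exact mul_le_of_le_one_right (norm_nonneg _) (pow_le_one₀ (norm_nonneg _) hw'.le)) hv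
    have h3 := tsum_mul_tsum_of_summable_norm s1 s2
    rw [(hF w hw).tsum_eq, ← Complex.conj_tsum, (hG w hw).tsum_eq] at h3
    rw [h3]
    refine tsum_congr fun p => ?_
    simp only [T, map_mul, map_pow]
    ring
  rw [h2] at h1
  have hinj : Function.Injective fun n : ℕ => (n, n) := fun a b h => (Prod.mk.inj h).1
  -- Off-diagonal terms integrate to zero, so only the diagonal of the double series remains.
  rw [← hinj.hasSum_iff] at h1
  · refine h1.congr_fun fun n => ?_
    simp only [Function.comp, T, integral_const_mul, integral_monomial hβ, if_true]
    ring
  · rintro ⟨j, l⟩ hp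
    have : j ≠ l := fun h => hp ⟨j, by simp [h]⟩
    simp [T, integral_const_mul, integral_monomial hβ, this]

/-! ### The Forelli–Rudin integral -/

/-- The absolute value of the Bergman kernel, `|1 - z w̄| ^ (-(2 + α))`. -/
noncomputable def absKernel (α : ℝ) (z w : ℂ) : ℝ := ‖1 - z * (starRingEnd ℂ) w‖ ^ (-(2 + α))

theorem absKernel_nonneg (α : ℝ) (z w : ℂ) : 0 ≤ absKernel α z w :=
  Real.rpow_nonneg (norm_nonneg _) _

theorem absKernel_comm (α : ℝ) (z w : ℂ) : absKernel α z w = absKernel α w z := by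
  rw [absKernel, absKernel, ← RCLike.norm_conj]
  simp [mul_comm]

theorem measurable_absKernel (α : ℝ) : Measurable fun x : ℂ × ℂ => absKernel α x.1 x.2 := by
  unfold absKernel
  fun_prop

theorem one_sub_norm_sq_pos {z : ℂ} (hz : z ∈ Metric.ball (0 : ℂ) 1) : 0 < 1 - ‖z‖ ^ 2 := by
  have : ‖z‖ < 1 := by simpa using hz
  nlinarith [norm_nonneg z]

theorem one_sub_norm_le {z w : ℂ} (hw : w ∈ Metric.ball (0 : ℂ) 1) :
    1 - ‖z‖ ≤ ‖1 - z * (starRingEnd ℂ) w‖ := by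
  have hw : ‖w‖ < 1 := by simpa using hw
  have h := norm_sub_norm_le (1 : ℂ) (z * (starRingEnd ℂ) w)
  rw [norm_one, norm_mul, RCLike.norm_conj] at h
  nlinarith [norm_nonneg z]

theorem absKernel_le {α : ℝ} (hα : -1 < α) {z w : ℂ} (hz : z ∈ Metric.ball (0 : ℂ) 1)
    (hw : w ∈ Metric.ball (0 : ℂ) 1) : absKernel α z w ≤ (1 - ‖z‖) ^ (-(2 + α)) := by
  have hz' : ‖z‖ < 1 := by simpa using hz
  exact Real.rpow_le_rpow_of_nonpos (by linarith) (one_sub_norm_le hw) (by linarith)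

theorem enorm_bergmanIntegrand (α : ℝ) (f : ℂ → ℂ) (z w : ℂ) :
    ‖bergmanIntegrand α f z w‖ₑ = ENNReal.ofReal (absKernel α z w) * ‖f w‖ₑ := by
  rw [← ofReal_norm, ← ofReal_norm,
    ← ENNReal.ofReal_mul (absKernel_nonneg _ _ _), bergmanIntegrand, norm_div,
    Complex.norm_cpow_real, absKernel, Real.rpow_neg (norm_nonneg _)]
  congr 1
  ring

theorem integrable_absKernel {α β : ℝ} (hα : -1 < α) (hβ : -1 < β) {z : ℂ}
    (hz : z ∈ Metric.ball (0 : ℂ) 1) : Integrable (absKernel α z) (diskMeasure β) := by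
  have := isProbabilityMeasure_diskMeasure hβ
  refine Integrable.of_bound (C := (1 - ‖z‖) ^ (-(2 + α)))
    ((measurable_absKernel α).comp measurable_prodMk_left).aestronglyMeasurable ?_
  filter_upwards [ae_diskMeasure_mem_ball β] with w hw
  rw [Real.norm_of_nonneg (absKernel_nonneg _ _ _)]
  exact absKernel_le hα hz hw

/-- Parseval applied to F = G = (1 - z̄ w)^(-(2+α)/2), since F conj F is the kernel modulus. -/
theorem hasSum_integral_absKernel {α β : ℝ} (hβ : -1 < β) {z : ℂ}
    (hz : z ∈ Metric.ball (0 : ℂ) 1) :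
    HasSum (fun n => negBinom ((2 + α) / 2) n ^ 2 / negBinom (β + 2) n * (‖z‖ ^ 2) ^ n)
      (∫ w, absKernel α z w ∂(diskMeasure β)) := by
  have hz' : ‖z‖ < 1 := by simpa using hz
  set c := (2 + α) / 2 with hc
  have hs : Summable fun n => ‖(negBinom c n : ℂ) * (starRingEnd ℂ) z ^ n‖ := by
    simpa using summable_negBinom (a := c) (norm_nonneg z) hz'
  have hF : ∀ w ∈ Metric.ball (0 : ℂ) 1, HasSum
      (fun n => (negBinom c n : ℂ) * (starRingEnd ℂ) z ^ n * w ^ n)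
      ((1 - (starRingEnd ℂ) z * w) ^ (-(c : ℂ))) := fun w hw => by
    have hw : ‖w‖ < 1 := by simpa using hw
    have := hasSum_negBinom c (z := (starRingEnd ℂ) z * w) (by
      rw [norm_mul, RCLike.norm_conj]; nlinarith [norm_nonneg z, norm_nonneg w])
    simpa only [mul_pow, mul_assoc] using this
  have h := hasSum_integral_mul_conj hβ hs hs hF hF
  have e : ∀ w, (1 - (starRingEnd ℂ) z * w) ^ (-(c : ℂ)) *
      (starRingEnd ℂ) ((1 - (starRingEnd ℂ) z * w) ^ (-(c : ℂ))) = (absKernel α z w : ℂ) := by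
    intro w
    rw [Complex.mul_conj, Complex.normSq_eq_norm_sq, ← Complex.ofReal_neg, Complex.norm_cpow_real,
      ← Real.rpow_mul_natCast (norm_nonneg _), absKernel, ← RCLike.norm_conj]
    congr 2
    · simp
    · rw [hc]; push_cast; ring
  simp only [e, integral_complex_ofReal] at h
  rw [← Complex.hasSum_ofReal]
  refine h.congr_fun fun n => ?_
  have h2 : (starRingEnd ℂ) z ^ n * z ^ n = ((‖z‖ : ℂ) ^ 2) ^ n := by
    rw [← mul_pow, mul_comm, Complex.mul_conj, Complex.normSq_eq_norm_sq]; push_cast; rfl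
  simp only [map_mul, map_pow, Complex.conj_ofReal, Complex.conj_conj, Complex.ofReal_mul,
    Complex.ofReal_div, Complex.ofReal_pow]
  rw [← h2]
  ring

/-- Both sides are power series in |z|², and the coefficients compare because (2+α)/2 + n is the
midpoint of b + n and α - b + 2 + n, where log-convexity of Γ applies. -/
theorem integral_absKernel_le {α b : ℝ} (hb : 0 < b) (hb' : b < 1 + α) {z : ℂ}
    (hz : z ∈ Metric.ball (0 : ℂ) 1) :
    (1 + α) / (1 + α - b) * ∫ w, absKernel α z w ∂(diskMeasure (α - b)) ≤
      (1 + α) * (Real.Gamma b * Real.Gamma (1 + α - b) / Real.Gamma ((2 + α) / 2) ^ 2) *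
        (1 - ‖z‖ ^ 2) ^ (-b) := by
  have hz' : ‖z‖ < 1 := by simpa using hz
  have h1 := (hasSum_integral_absKernel (α := α) (β := α - b) (by linarith) hz).mul_left
    ((1 + α) / (1 + α - b))
  have h2 := (hasSum_negBinom_real b (x := ‖z‖ ^ 2) (by
    rw [abs_of_nonneg (by positivity)]; nlinarith [norm_nonneg z])).mul_left
    ((1 + α) * (Real.Gamma b * Real.Gamma (1 + α - b) / Real.Gamma ((2 + α) / 2) ^ 2))
  refine hasSum_le (fun n => ?_) h1 h2
  rw [← mul_assoc, ← mul_assoc]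
  refine mul_le_mul_of_nonneg_right ?_ (by positivity)
  have hc : 0 < (2 + α) / 2 := by linarith
  have hd : 0 < 1 + α - b := by linarith
  have hn : (0 : ℝ) ≤ n := n.cast_nonneg
  have key := Gamma_sq_le (x := b + n) (y := α - b + 2 + n) (z := (2 + α) / 2 + n)
    (by linarith) (by linarith) (by ring)
  rw [Gamma_add_nat hb, Gamma_add_nat hc, Gamma_add_nat (by linarith : 0 < α - b + 2),
    show α - b + 2 = 1 + α - b + 1 by ring, Real.Gamma_add_one hd.ne'] at key
  rw [show α - b + 2 = 1 + α - b + 1 by ring]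
  have g1 := Real.Gamma_pos_of_pos hb
  have g2 := Real.Gamma_pos_of_pos hc
  have g3 := Real.Gamma_pos_of_pos hd
  have g4 := negBinom_pos (a := 1 + α - b + 1) (by linarith) n
  have hfac : (0 : ℝ) < (n.factorial : ℝ) ^ 2 := by positivity
  have key2 : Real.Gamma ((2 + α) / 2) ^ 2 * negBinom ((2 + α) / 2) n ^ 2 ≤
      Real.Gamma b * negBinom b n * ((1 + α - b) * Real.Gamma (1 + α - b) *
        negBinom (1 + α - b + 1) n) := by
    refine le_of_mul_le_mul_left ?_ hfac
    linarith
  rw [div_mul_div_comm, ← mul_div_assoc, div_mul_eq_mul_div,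
    div_le_div_iff₀ (by positivity) (by positivity)]
  have : 0 < 1 + α := by linarith
  nlinarith [mul_le_mul_of_nonneg_left key2 this.le]

theorem lintegral_diskMeasure (β : ℝ) {g : ℂ → ENNReal} (hg : Measurable g) :
    ∫⁻ z, g z ∂(diskMeasure β) = ∫⁻ z in Metric.ball (0 : ℂ) 1,
      ENNReal.ofReal ((1 + β) * (1 - ‖z‖ ^ 2) ^ β * Real.pi⁻¹) * g z := by
  rw [diskMeasure, lintegral_withDensity_eq_lintegral_mul _
    (measurable_diskDensity β).ennreal_ofReal hg]
  rfl

/-- The weight is absorbed into the measure; the constant is the ratio of the normalizations of dA_α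
and dA_(α-b). -/
theorem lintegral_absKernel_mul_weight {α b : ℝ} (hα : -1 < α) (hb' : b < 1 + α) (z : ℂ) :
    ∫⁻ w, ENNReal.ofReal (absKernel α z w) * ENNReal.ofReal ((1 - ‖w‖ ^ 2) ^ (-b))
        ∂(diskMeasure α) = ENNReal.ofReal ((1 + α) / (1 + α - b)) *
        ∫⁻ w, ENNReal.ofReal (absKernel α z w) ∂(diskMeasure (α - b)) := by
  have hmk : Measurable fun w => absKernel α z w := by
    unfold absKernel
    fun_prop
  have hd : 0 < 1 + α - b := by linarith
  have h1 := lintegral_diskMeasure α (g := fun w => ENNReal.ofReal (absKernel α z w) *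
    ENNReal.ofReal ((1 - ‖w‖ ^ 2) ^ (-b))) (hmk.ennreal_ofReal.mul (by fun_prop))
  have h2 := lintegral_diskMeasure (α - b) hmk.ennreal_ofReal
  rw [h1, h2, ← lintegral_const_mul' _ _ ENNReal.ofReal_ne_top]
  refine setLIntegral_congr_fun Metric.isOpen_ball.measurableSet fun w hw => ?_
  have h0 := one_sub_norm_sq_pos hw
  have hk := absKernel_nonneg α z w
  have h2 : 0 ≤ 1 + α := by linarith
  rw [← ENNReal.ofReal_mul hk, ← ENNReal.ofReal_mul (diskDensity_nonneg hα hw),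
    ← ENNReal.ofReal_mul (diskDensity_nonneg (by linarith) hw),
    ← ENNReal.ofReal_mul (by positivity), sub_eq_add_neg α b, Real.rpow_add h0,
    ← sub_eq_add_neg α b]
  congr 1
  rw [← add_sub_assoc]
  field_simp

/-- The Forelli–Rudin estimate with an explicit constant. -/
theorem lintegral_absKernel_le {α b : ℝ} (hb : 0 < b) (hb' : b < 1 + α) {z : ℂ}
    (hz : z ∈ Metric.ball (0 : ℂ) 1) :
    ∫⁻ w, ENNReal.ofReal (absKernel α z w) * ENNReal.ofReal ((1 - ‖w‖ ^ 2) ^ (-b))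
        ∂(diskMeasure α) ≤
      ENNReal.ofReal ((1 + α) *
        (Real.Gamma b * Real.Gamma (1 + α - b) / Real.Gamma ((2 + α) / 2) ^ 2)) *
        ENNReal.ofReal ((1 - ‖z‖ ^ 2) ^ (-b)) := by
  have hα : -1 < α := by linarith
  have hd : 0 < 1 + α - b := by linarith
  rw [lintegral_absKernel_mul_weight hα hb' z,
    ← ofReal_integral_eq_lintegral_ofReal (integrable_absKernel hα (by linarith) hz)
    (ae_of_all _ fun w => absKernel_nonneg α z w),
    ← ENNReal.ofReal_mul (div_nonneg (by linarith) hd.le)]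
  have g1 := Real.Gamma_pos_of_pos hb
  have g3 := Real.Gamma_pos_of_pos hd
  have h2 : 0 < 1 + α := by linarith
  rw [← ENNReal.ofReal_mul (by positivity)]
  exact ENNReal.ofReal_le_ofReal (integral_absKernel_le hb hb' hz)

/-! ### Schur's test and the upper bound -/

/-- **Schur's test**. -/
theorem lintegral_rpow_le_of_schur {X : Type*} [MeasurableSpace X] {μ : Measure X} [SFinite μ]
    {k : X → X → ENNReal} (hk : Measurable (Function.uncurry k)) {h : X → ENNReal}
    (hh : Measurable h) (hpos : ∀ᵐ x ∂μ, h x ≠ 0) (hfin : ∀ᵐ x ∂μ, h x ≠ ⊤) {p q : ℝ}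
    (hpq : p.HolderConjugate q) {K : ENNReal} (hK : K ≠ 0) (hK' : K ≠ ⊤)
    (h1 : ∀ᵐ z ∂μ, ∫⁻ w, k z w * h w ^ q ∂μ ≤ K * h z ^ q)
    (h2 : ∀ᵐ w ∂μ, ∫⁻ z, k z w * h z ^ p ∂μ ≤ K * h w ^ p) {g : X → ENNReal}
    (hg : AEMeasurable g μ) :
    ∫⁻ z, (∫⁻ w, k z w * g w ∂μ) ^ p ∂μ ≤ K ^ p * ∫⁻ w, g w ^ p ∂μ := by
  have hp := hpq.pos
  have hq := hpq.symm.pos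
  have hkz : ∀ z, Measurable (k z) := fun z => hk.comp measurable_prodMk_left
  have step : ∀ᵐ z ∂μ, (∫⁻ w, k z w * g w ∂μ) ^ p ≤
      K ^ (p / q) * ∫⁻ w, h z ^ p * (k z w * (h w ^ (-p) * g w ^ p)) ∂μ := by
    filter_upwards [h1] with z hz
    -- Preparation for Hölder: split k = k^(1/p) k^(1/q) and insert h⁻¹ h, so that the factor
    -- without g is controlled by `h1`.
    have e : ∫⁻ w, k z w * g w ∂μ =
        ∫⁻ w, ((fun w => k z w ^ (1 / p) * ((h w)⁻¹ * g w)) * fun w => k z w ^ (1 / q) * h w) w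
          ∂μ := by
      refine lintegral_congr_ae ?_
      filter_upwards [hpos, hfin] with w hw hw'
      have : k z w ^ (1 / p) * k z w ^ (1 / q) = k z w := by
        rw [← ENNReal.rpow_add_of_nonneg _ _ (by positivity) (by positivity)]
        simp [hpq.inv_add_inv_eq_one]
      calc k z w * g w = (k z w ^ (1 / p) * k z w ^ (1 / q)) * (((h w)⁻¹ * h w) * g w) := by
            rw [this, ENNReal.inv_mul_cancel hw hw', one_mul]
        _ = _ := by simp only [Pi.mul_apply]; ring
    have hol := ENNReal.lintegral_mul_le_Lp_mul_Lq μ hpq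
      (f := fun w => k z w ^ (1 / p) * ((h w)⁻¹ * g w)) (g := fun w => k z w ^ (1 / q) * h w)
      (by have := hkz z; fun_prop) (by have := hkz z; fun_prop)
    rw [← e] at hol
    have e1 : ∀ w, (k z w ^ (1 / p) * ((h w)⁻¹ * g w)) ^ p =
        k z w * (h w ^ (-p) * g w ^ p) := fun w => by
      rw [ENNReal.mul_rpow_of_nonneg _ _ hp.le, ENNReal.mul_rpow_of_nonneg _ _ hp.le,
        ← ENNReal.rpow_mul, one_div_mul_cancel hp.ne', ENNReal.rpow_one, ENNReal.inv_rpow,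
        ENNReal.rpow_neg]
    have e2 : ∀ w, (k z w ^ (1 / q) * h w) ^ q = k z w * h w ^ q := fun w => by
      rw [ENNReal.mul_rpow_of_nonneg _ _ hq.le, ← ENNReal.rpow_mul, one_div_mul_cancel hq.ne',
        ENNReal.rpow_one]
    simp only [e1, e2] at hol
    calc (∫⁻ w, k z w * g w ∂μ) ^ p
        ≤ ((∫⁻ w, k z w * (h w ^ (-p) * g w ^ p) ∂μ) ^ (1 / p) *
            (K * h z ^ q) ^ (1 / q)) ^ p := by
          refine ENNReal.rpow_le_rpow (hol.trans ?_) hp.le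
          gcongr
      _ = K ^ (p / q) * (h z ^ p * ∫⁻ w, k z w * (h w ^ (-p) * g w ^ p) ∂μ) := by
          rw [ENNReal.mul_rpow_of_nonneg _ _ hp.le, ← ENNReal.rpow_mul, one_div_mul_cancel hp.ne',
            ENNReal.rpow_one, ENNReal.mul_rpow_of_nonneg _ _ (by positivity),
            ← ENNReal.rpow_mul (h z), mul_one_div_cancel hq.ne', ENNReal.rpow_one,
            ENNReal.mul_rpow_of_nonneg _ _ hp.le, ← ENNReal.rpow_mul K, one_div_mul_eq_div]
          ring
      _ = _ := by
          congr 1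
          rw [lintegral_const_mul'' _ (by have := hkz z; fun_prop)]
  calc ∫⁻ z, (∫⁻ w, k z w * g w ∂μ) ^ p ∂μ
      ≤ ∫⁻ z, K ^ (p / q) * ∫⁻ w, h z ^ p * (k z w * (h w ^ (-p) * g w ^ p)) ∂μ ∂μ :=
        lintegral_mono_ae step
    _ = K ^ (p / q) * ∫⁻ w, ∫⁻ z, h z ^ p * (k z w * (h w ^ (-p) * g w ^ p)) ∂μ ∂μ := by
        rw [lintegral_const_mul' _ _ (ENNReal.rpow_ne_top_of_nonneg (by positivity) hK'),
          lintegral_lintegral_swap]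
        have hk' : AEMeasurable (fun x : X × X => k x.1 x.2) (μ.prod μ) := hk.aemeasurable
        have hg' : AEMeasurable (fun x : X × X => g x.2) (μ.prod μ) := hg.comp_snd
        simp only [Function.uncurry_def]
        fun_prop
    _ ≤ K ^ (p / q) * ∫⁻ w, K * g w ^ p ∂μ := by
        refine mul_le_mul_right (lintegral_mono_ae ?_) _
        filter_upwards [h2, hpos, hfin] with w hw hw0 hwt
        have hkw : Measurable fun z => k z w := hk.comp measurable_prodMk_right
        calc ∫⁻ z, h z ^ p * (k z w * (h w ^ (-p) * g w ^ p)) ∂μ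
            = (h w ^ (-p) * g w ^ p) * ∫⁻ z, k z w * h z ^ p ∂μ := by
              rw [← lintegral_const_mul _ (by fun_prop)]
              exact lintegral_congr fun z => by ring
          _ ≤ (h w ^ (-p) * g w ^ p) * (K * h w ^ p) := by gcongr
          _ = (h w ^ (-p) * h w ^ p) * (K * g w ^ p) := by ring
          _ = K * g w ^ p := by
              rw [ENNReal.rpow_neg, ENNReal.inv_mul_cancel
                (by simp [hw0, hwt]) (by simp [hw0, hwt]), one_mul]
    _ = K ^ p * ∫⁻ w, g w ^ p ∂μ := by
        rw [lintegral_const_mul' _ _ hK', ← mul_assoc]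
        congr 1
        -- The constants K^(p/q) and K combine to K^p since p/q = p - 1.
        nth_rw 2 [← ENNReal.rpow_one K]
        rw [← ENNReal.rpow_add _ _ hK hK', hpq.div_conj_eq_sub_one]
        congr 1
        ring

/-- The upper bound for the norm of the Bergman projection. -/
noncomputable def bergmanUpper (p q α : ℝ) : ℝ :=
  (1 + α) * (Real.Gamma ((1 + α) / p) * Real.Gamma ((1 + α) / q) / Real.Gamma ((2 + α) / 2) ^ 2)

theorem bergmanUpper_pos {p q α : ℝ} (hpq : p.HolderConjugate q) (hα : -1 < α) :
    0 < bergmanUpper p q α := by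
  have hp := hpq.pos
  have hq := hpq.symm.pos
  have h1 : 0 < 1 + α := by linarith
  have h2 : 0 < 2 + α := by linarith
  have g1 := Real.Gamma_pos_of_pos (div_pos h1 hp)
  have g2 := Real.Gamma_pos_of_pos (div_pos h1 hq)
  have g3 := Real.Gamma_pos_of_pos (half_pos h2)
  unfold bergmanUpper
  positivity

/-- With h = (1-|w|²)^(-(1+α)/(pq)), the powers h^q and h^p carry the exponents b = (1+α)/p and b =
(1+α)/q. These sum to 1 + α, so the Forelli–Rudin constant, symmetric under b ↔ 1 + α - b, is the
same in both Schur conditions. -/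
theorem lintegral_absKernel_rpow_le {p q α : ℝ} (hpq : p.HolderConjugate q) (hα : -1 < α)
    {g : ℂ → ENNReal} (hg : AEMeasurable g (diskMeasure α)) :
    ∫⁻ z, (∫⁻ w, ENNReal.ofReal (absKernel α z w) * g w ∂(diskMeasure α)) ^ p ∂(diskMeasure α) ≤
      ENNReal.ofReal (bergmanUpper p q α) ^ p * ∫⁻ w, g w ^ p ∂(diskMeasure α) := by
  have := isProbabilityMeasure_diskMeasure hα
  have hp := hpq.pos
  have hq := hpq.symm.pos
  have hα' : 0 < 1 + α := by linarith
  have hK := bergmanUpper_pos hpq hα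
  have hpow : ∀ {r s : ℝ}, 0 < r → 0 < s → ∀ z ∈ Metric.ball (0 : ℂ) 1,
      ENNReal.ofReal ((1 - ‖z‖ ^ 2) ^ (-((1 + α) / (r * s)))) ^ s =
        ENNReal.ofReal ((1 - ‖z‖ ^ 2) ^ (-((1 + α) / r))) := by
    intro r s hr hs z hz
    have h0 := one_sub_norm_sq_pos hz
    rw [ENNReal.ofReal_rpow_of_nonneg (by positivity) hs.le, ← Real.rpow_mul h0.le]
    congr 2
    field_simp
  have hest : ∀ {r s : ℝ}, r.HolderConjugate s → ∀ᵐ z ∂(diskMeasure α),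
      ∫⁻ w, ENNReal.ofReal (absKernel α z w) *
        ENNReal.ofReal ((1 - ‖w‖ ^ 2) ^ (-((1 + α) / (r * s)))) ^ s ∂(diskMeasure α) ≤
      ENNReal.ofReal (bergmanUpper r s α) *
        ENNReal.ofReal ((1 - ‖z‖ ^ 2) ^ (-((1 + α) / (r * s)))) ^ s := by
    intro r s hrs
    filter_upwards [ae_diskMeasure_mem_ball α] with z hz
    have e : 1 + α - (1 + α) / r = (1 + α) / s := by
      rw [div_eq_mul_inv, div_eq_mul_inv, ← hrs.one_sub_inv]; ring
    have hb : (1 + α) / r < 1 + α := by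
      have := div_pos hα' hrs.symm.pos
      linarith
    have key := lintegral_absKernel_le (div_pos hα' hrs.pos) hb hz
    rw [e] at key
    rw [hpow hrs.pos hrs.symm.pos z hz]
    refine le_trans (le_of_eq (lintegral_congr_ae ?_)) key
    filter_upwards [ae_diskMeasure_mem_ball α] with w hw
    rw [hpow hrs.pos hrs.symm.pos w hw]
  have hsymm : bergmanUpper q p α = bergmanUpper p q α := by
    unfold bergmanUpper; ring
  refine lintegral_rpow_le_of_schur (k := fun z w => ENNReal.ofReal (absKernel α z w))
    (h := fun w => ENNReal.ofReal ((1 - ‖w‖ ^ 2) ^ (-((1 + α) / (p * q)))))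
    (measurable_absKernel α).ennreal_ofReal (by fun_prop) ?_ ?_ hpq
    (by simpa using hK) ENNReal.ofReal_ne_top (hest hpq) ?_ hg
  · filter_upwards [ae_diskMeasure_mem_ball α] with w hw
    have h0 := one_sub_norm_sq_pos hw
    have : 0 < (1 - ‖w‖ ^ 2) ^ (-((1 + α) / (p * q))) := by positivity
    simpa using this
  · exact ae_of_all _ fun _ => ENNReal.ofReal_ne_top
  · have := hest hpq.symm
    rw [mul_comm q p, hsymm] at this
    simpa only [absKernel_comm] using this

theorem integrable_bergmanIntegrand {α : ℝ} (hα : -1 < α) {f : ℂ → ℂ}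
    (hf : Integrable f (diskMeasure α)) {z : ℂ} (hz : z ∈ Metric.ball (0 : ℂ) 1) :
    Integrable (bergmanIntegrand α f z) (diskMeasure α) := by
  have hz' : ‖z‖ < 1 := by simpa using hz
  refine (hf.norm.const_mul ((1 - ‖z‖) ^ (-(2 + α)))).mono' ?_ ?_
  · have : Measurable fun w : ℂ => (1 - z * (starRingEnd ℂ) w) ^ ((2 + α : ℝ) : ℂ) := by fun_prop
    exact (hf.aestronglyMeasurable.aemeasurable.div this.aemeasurable).aestronglyMeasurable
  · filter_upwards [ae_diskMeasure_mem_ball α] with w hw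
    have h := enorm_bergmanIntegrand α f z w
    rw [← ofReal_norm, ← ofReal_norm, ← ENNReal.ofReal_mul (absKernel_nonneg _ _ _),
      ENNReal.ofReal_eq_ofReal_iff (norm_nonneg _)
        (mul_nonneg (absKernel_nonneg _ _ _) (norm_nonneg _))] at h
    rw [h]
    exact mul_le_mul_of_nonneg_right (absKernel_le hα hz hw) (norm_nonneg _)

theorem aestronglyMeasurable_bergmanProj {α : ℝ} (hα : -1 < α) {f : ℂ → ℂ}
    (hf : AEStronglyMeasurable f (diskMeasure α)) :
    AEStronglyMeasurable (bergmanProj α f) (diskMeasure α) := by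
  have := isProbabilityMeasure_diskMeasure hα
  -- Changing f on a null set leaves the integral unchanged at every z, so f may be taken
  -- measurable.
  have e : bergmanProj α f = bergmanProj α (hf.mk f) := by
    ext z
    refine integral_congr_ae ?_
    filter_upwards [hf.ae_eq_mk] with w hw
    rw [bergmanIntegrand, bergmanIntegrand, hw]
  rw [e]
  have hm : Measurable (hf.mk f) := hf.stronglyMeasurable_mk.measurable
  have : Measurable fun x : ℂ × ℂ => bergmanIntegrand α (hf.mk f) x.1 x.2 := by
    unfold bergmanIntegrand
    fun_prop
  exact (this.stronglyMeasurable.integral_prod_right').aestronglyMeasurable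

theorem eLpNorm_bergmanProj_le {p q α : ℝ} (hpq : p.HolderConjugate q) (hα : -1 < α) {f : ℂ → ℂ}
    (hf : AEStronglyMeasurable f (diskMeasure α)) :
    eLpNorm (bergmanProj α f) (ENNReal.ofReal p) (diskMeasure α) ≤
      ENNReal.ofReal (bergmanUpper p q α) * eLpNorm f (ENNReal.ofReal p) (diskMeasure α) := by
  have hp := hpq.pos
  have h0 : ENNReal.ofReal p ≠ 0 := by simpa using hp
  rw [eLpNorm_eq_lintegral_rpow_enorm_toReal h0 ENNReal.ofReal_ne_top,
    eLpNorm_eq_lintegral_rpow_enorm_toReal h0 ENNReal.ofReal_ne_top, ENNReal.toReal_ofReal hp.le]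
  have h1 : ∫⁻ z, ‖bergmanProj α f z‖ₑ ^ p ∂(diskMeasure α) ≤
      ENNReal.ofReal (bergmanUpper p q α) ^ p * ∫⁻ w, ‖f w‖ₑ ^ p ∂(diskMeasure α) := by
    refine le_trans (lintegral_mono fun z => ?_) (lintegral_absKernel_rpow_le hpq hα hf.enorm)
    refine ENNReal.rpow_le_rpow ((enorm_integral_le_lintegral_enorm _).trans_eq ?_) hp.le
    exact lintegral_congr fun w => enorm_bergmanIntegrand α f z w
  refine (ENNReal.rpow_le_rpow h1 (by positivity : 0 ≤ 1 / p)).trans_eq ?_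
  rw [ENNReal.mul_rpow_of_nonneg _ _ (by positivity), ← ENNReal.rpow_mul,
    mul_one_div_cancel hp.ne', ENNReal.rpow_one]

theorem memLp_bergmanProj {p q α : ℝ} (hpq : p.HolderConjugate q) (hα : -1 < α) {f : ℂ → ℂ}
    (hf : MemLp f (ENNReal.ofReal p) (diskMeasure α)) :
    MemLp (bergmanProj α f) (ENNReal.ofReal p) (diskMeasure α) :=
  ⟨aestronglyMeasurable_bergmanProj hα hf.1, (eLpNorm_bergmanProj_le hpq hα hf.1).trans_lt
    (ENNReal.mul_lt_top ENNReal.ofReal_lt_top hf.2)⟩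

theorem bergmanNorm_le {p q α : ℝ} (hpq : p.HolderConjugate q) (hα : -1 < α) :
    bergmanNorm p α ≤ ENNReal.ofReal (bergmanUpper p q α) :=
  iSup_le fun _ => iSup_le fun hf => iSup_le fun _ =>
    ENNReal.div_le_of_le_mul (eLpNorm_bergmanProj_le hpq hα hf.1)

theorem eLpNorm_bergmanProj_le_bergmanNorm {p α : ℝ} {f : ℂ → ℂ} (hp : 0 < p)
    (hf : MemLp f (ENNReal.ofReal p) (diskMeasure α)) (hf0 : ¬ f =ᵐ[diskMeasure α] 0) :
    eLpNorm (bergmanProj α f) (ENNReal.ofReal p) (diskMeasure α) ≤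
      bergmanNorm p α * eLpNorm f (ENNReal.ofReal p) (diskMeasure α) := by
  have h0 : ENNReal.ofReal p ≠ 0 := by simpa using hp
  rw [← ENNReal.div_le_iff (by rwa [Ne, eLpNorm_eq_zero_iff hf.1 h0]) hf.2.ne]
  exact le_iSup_of_le f (le_iSup_of_le hf (le_iSup_of_le hf0 le_rfl))

/-! ### The lower bound as α → -1 -/

theorem continuousAt_Gamma_of_pos {s : ℝ} (hs : 0 < s) : ContinuousAt Real.Gamma s :=
  (Real.differentiableAt_Gamma fun m => by
    have : (0 : ℝ) ≤ m := m.cast_nonneg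
    linarith).continuousAt

/-- At α = -1 the quotient is Γ(1/p) Γ(1 - 1/p) / Γ(1/2)², and the reflection formula evaluates it.
-/
theorem tendsto_lower_bound {p q : ℝ} (hpq : p.HolderConjugate q) :
    Tendsto (fun α : ℝ => Real.Gamma ((2 + α) / p) * Real.Gamma ((2 + α) / q) /
      Real.Gamma ((2 + α) / 2) ^ 2) (𝓝[>] (-1)) (𝓝 (1 / Real.sin (Real.pi / p))) := by
  have hG : ∀ {r : ℝ}, 0 < r → Tendsto (fun α : ℝ => Real.Gamma ((2 + α) / r)) (𝓝 (-1))
      (𝓝 (Real.Gamma (1 / r))) := fun {r} hr => by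
    refine (continuousAt_Gamma_of_pos (one_div_pos.2 hr)).tendsto.comp ?_
    have : Continuous fun α : ℝ => (2 + α) / r := by fun_prop
    have := this.tendsto (-1)
    norm_num at this
    simpa using this
  have h := ((hG hpq.pos).mul (hG hpq.symm.pos)).div ((hG two_pos).pow 2)
    (by rw [Real.Gamma_one_half_eq]; positivity)
  refine (tendsto_nhdsWithin_of_tendsto_nhds h).congr' ?_ |>.trans_eq ?_
  · exact Eventually.of_forall fun _ => rfl
  · congr 1
    rw [Real.Gamma_one_half_eq, Real.sq_sqrt Real.pi_pos.le, one_div q, ← hpq.one_sub_inv,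
      one_div p, Real.Gamma_mul_Gamma_one_sub, div_div_cancel_left' Real.pi_ne_zero,
      ← div_eq_mul_inv, one_div]

/-! ### Test functions and their moments -/

/-- The function `(1 - ρ w) ^ (-a) * conj ((1 - ρ w) ^ (-b))`. -/
noncomputable def testFun (a b ρ : ℝ) (w : ℂ) : ℂ :=
  (1 - ρ * w) ^ (-(a : ℂ)) * (starRingEnd ℂ) ((1 - ρ * w) ^ (-(b : ℂ)))

theorem measurable_testFun (a b ρ : ℝ) : Measurable (testFun a b ρ) := by
  unfold testFun
  fun_prop

theorem one_sub_mul_ne_zero {ρ : ℝ} (h0 : 0 ≤ ρ) (h1 : ρ < 1) {w : ℂ}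
    (hw : w ∈ Metric.ball (0 : ℂ) 1) : 1 - ρ * w ≠ 0 := by
  have hw : ‖w‖ < 1 := by simpa using hw
  intro h
  have h2 : ‖(ρ : ℂ) * w‖ = 1 := by rw [← sub_eq_zero.1 h, norm_one]
  rw [norm_mul, Complex.norm_of_nonneg h0] at h2
  nlinarith [norm_nonneg w]

theorem norm_testFun {a b ρ : ℝ} (h0 : 0 ≤ ρ) (h1 : ρ < 1) {w : ℂ}
    (hw : w ∈ Metric.ball (0 : ℂ) 1) : ‖testFun a b ρ w‖ = ‖1 - ρ * w‖ ^ (-(a + b)) := by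
  have h := norm_pos_iff.2 (one_sub_mul_ne_zero h0 h1 hw)
  rw [testFun, norm_mul, RCLike.norm_conj, ← Complex.ofReal_neg, ← Complex.ofReal_neg,
    Complex.norm_cpow_real, Complex.norm_cpow_real, ← Real.rpow_add h]
  congr 1
  ring

theorem hasSum_one_sub_mul_cpow (a : ℝ) {ρ : ℝ} (h0 : 0 ≤ ρ) (h1 : ρ < 1) {w : ℂ}
    (hw : w ∈ Metric.ball (0 : ℂ) 1) :
    HasSum (fun n => (negBinom a n * ρ ^ n : ℂ) * w ^ n) ((1 - ρ * w) ^ (-(a : ℂ))) := by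
  have hw : ‖w‖ < 1 := by simpa using hw
  have := hasSum_negBinom a (z := ρ * w) (by
    rw [norm_mul, Complex.norm_of_nonneg h0]; nlinarith [norm_nonneg w])
  simpa only [mul_pow, mul_assoc] using this

theorem summable_norm_negBinom_mul (a : ℝ) {ρ : ℝ} (h0 : 0 ≤ ρ) (h1 : ρ < 1) :
    Summable fun n => ‖(negBinom a n * ρ ^ n : ℂ)‖ := by
  simpa [abs_of_nonneg h0] using summable_negBinom (a := a) h0 h1

theorem norm_one_sub_mul_cpow_le (a : ℝ) {ρ : ℝ} (h0 : 0 ≤ ρ) (h1 : ρ < 1) {w : ℂ}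
    (hw : w ∈ Metric.ball (0 : ℂ) 1) :
    ‖(1 - ρ * w) ^ (-(a : ℂ))‖ ≤ ∑' n, ‖(negBinom a n * ρ ^ n : ℂ)‖ := by
  have hw' : ‖w‖ < 1 := by simpa using hw
  rw [← (hasSum_one_sub_mul_cpow a h0 h1 hw).tsum_eq]
  refine tsum_of_norm_bounded (summable_norm_negBinom_mul a h0 h1).hasSum fun n => ?_
  rw [norm_mul, norm_pow]
  exact mul_le_of_le_one_right (norm_nonneg _) (pow_le_one₀ (norm_nonneg _) hw'.le)

theorem exists_norm_testFun_le (a b : ℝ) {ρ : ℝ} (h0 : 0 ≤ ρ) (h1 : ρ < 1) :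
    ∃ C, 0 ≤ C ∧ ∀ w ∈ Metric.ball (0 : ℂ) 1, ‖testFun a b ρ w‖ ≤ C := by
  refine ⟨(∑' n, ‖(negBinom a n * ρ ^ n : ℂ)‖) * ∑' n, ‖(negBinom b n * ρ ^ n : ℂ)‖,
    mul_nonneg (tsum_nonneg fun _ => norm_nonneg _) (tsum_nonneg fun _ => norm_nonneg _),
    fun w hw => ?_⟩
  rw [testFun, norm_mul, RCLike.norm_conj]
  exact mul_le_mul (norm_one_sub_mul_cpow_le a h0 h1 hw) (norm_one_sub_mul_cpow_le b h0 h1 hw)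
    (norm_nonneg _) (tsum_nonneg fun _ => norm_nonneg _)

theorem memLp_testFun {α : ℝ} (hα : -1 < α) (a b : ℝ) {ρ : ℝ} (h0 : 0 ≤ ρ) (h1 : ρ < 1)
    (p : ENNReal) : MemLp (testFun a b ρ) p (diskMeasure α) := by
  have := isProbabilityMeasure_diskMeasure hα
  obtain ⟨C, -, hC⟩ := exists_norm_testFun_le a b h0 h1
  exact MemLp.of_bound (measurable_testFun a b ρ).aestronglyMeasurable C
    ((ae_diskMeasure_mem_ball α).mono hC)

theorem testFun_ne_zero {α : ℝ} (hα : -1 < α) (a b : ℝ) {ρ : ℝ} (h0 : 0 ≤ ρ) (h1 : ρ < 1) :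
    ¬ testFun a b ρ =ᵐ[diskMeasure α] 0 := by
  have := isProbabilityMeasure_diskMeasure hα
  intro h
  obtain ⟨w, hw, hw'⟩ := (h.and (ae_diskMeasure_mem_ball α)).exists
  have h2 := norm_testFun (a := a) (b := b) h0 h1 hw'
  have h3 := norm_pos_iff.2 (one_sub_mul_ne_zero h0 h1 hw')
  rw [hw, Pi.zero_apply, norm_zero] at h2
  exact (Real.rpow_pos_of_pos h3 _).ne h2

/-- The moment `∫ testFun a b ρ w * conj w ^ n` as a series; `A = 2 + α`. -/
noncomputable def testMoment (A a b ρ : ℝ) (n : ℕ) : ℝ :=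
  ∑' k, negBinom a (k + n) / negBinom A (k + n) * negBinom b k * ρ ^ (2 * k + n)

theorem integral_testFun_mul_conj_pow {α : ℝ} (hα : -1 < α) (a b : ℝ) {ρ : ℝ} (h0 : 0 ≤ ρ)
    (h1 : ρ < 1) (n : ℕ) :
    ∫ w, testFun a b ρ w * (starRingEnd ℂ) w ^ n ∂(diskMeasure α) =
      testMoment (2 + α) a b ρ n := by
  -- Coefficients of w^n (1-ρw)^(-b): the factor conj(w)^n is moved onto the conjugated series,
  -- which shifts it by n.
  let v : ℕ → ℂ := fun j => if j < n then 0 else negBinom b (j - n) * ρ ^ (j - n)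
  have hv0 : ∀ (F : ℕ → ℂ → ℂ), (∀ j, F j 0 = 0) → ∑ i ∈ Finset.range n, F i (v i) = 0 :=
    fun F hF => Finset.sum_eq_zero fun i hi => by
      simp only [v, if_pos (Finset.mem_range.1 hi), hF]
  have hvn : ∀ k, v (k + n) = negBinom b k * ρ ^ k := fun k => by simp [v]
  have hv : Summable fun j => ‖v j‖ := by
    rw [← summable_nat_add_iff n]
    simpa only [hvn] using summable_norm_negBinom_mul b h0 h1
  have hG : ∀ w ∈ Metric.ball (0 : ℂ) 1,
      HasSum (fun j => v j * w ^ j) (w ^ n * (1 - ρ * w) ^ (-(b : ℂ))) := by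
    intro w hw
    rw [← hasSum_nat_add_iff' n, hv0 (fun j x => x * w ^ j) (by simp), sub_zero]
    refine ((hasSum_one_sub_mul_cpow b h0 h1 hw).mul_left (w ^ n)).congr_fun fun k => ?_
    rw [hvn, pow_add]
    ring
  have h := hasSum_integral_mul_conj hα (summable_norm_negBinom_mul a h0 h1) hv
    (fun w hw => hasSum_one_sub_mul_cpow a h0 h1 hw) hG
  rw [← hasSum_nat_add_iff' n, hv0 (fun j x => negBinom a j * ρ ^ j * (starRingEnd ℂ) x /
    negBinom (α + 2) j) (by simp), sub_zero] at h
  have e : ∀ w, testFun a b ρ w * (starRingEnd ℂ) w ^ n = (1 - ρ * w) ^ (-(a : ℂ)) *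
      (starRingEnd ℂ) (w ^ n * (1 - ρ * w) ^ (-(b : ℂ))) := fun w => by
    rw [testFun, map_mul, map_pow]; ring
  simp only [e]
  rw [← h.tsum_eq, testMoment, Complex.ofReal_tsum]
  refine tsum_congr fun k => ?_
  rw [hvn, add_comm α 2]
  push_cast
  simp only [map_mul, map_pow, Complex.conj_ofReal]
  ring

/-- A crude geometric bound, used to integrate the series of P f term by term. -/
theorem abs_testMoment_le {A a : ℝ} (ha : 0 < a) (haA : a ≤ A) (b : ℝ) {ρ : ℝ} (h0 : 0 ≤ ρ)
    (h1 : ρ < 1) (n : ℕ) :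
    |testMoment A a b ρ n| ≤ (∑' k, |negBinom b k| * (ρ ^ 2) ^ k) * ρ ^ n := by
  have hs := (summable_negBinom (a := b) (sq_nonneg ρ) (by nlinarith)).mul_right (ρ ^ n)
  rw [← tsum_mul_right, testMoment, ← Real.norm_eq_abs]
  refine tsum_of_norm_bounded hs.hasSum fun k => ?_
  have hr : negBinom a (k + n) / negBinom A (k + n) ≤ 1 :=
    div_le_one_of_le₀ (negBinom_mono ha.le haA _) (negBinom_pos (ha.trans_le haA) _).le
  have hr0 : 0 ≤ negBinom a (k + n) / negBinom A (k + n) :=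
    div_nonneg (negBinom_pos ha _).le (negBinom_pos (ha.trans_le haA) _).le
  rw [Real.norm_eq_abs, abs_mul, abs_mul, abs_of_nonneg hr0, abs_of_nonneg (pow_nonneg h0 _),
    ← pow_mul, mul_assoc |_|, ← pow_add, mul_assoc]
  exact mul_le_of_le_one_left (by positivity) hr

/-- Write the ratio of coefficients as a beta integral and sum the binomial series in b inside it.
The series may have terms of both signs when b < 0, whereas this integrand is nonnegative and has a
visible limit as ρ → 1. -/
theorem testMoment_eq_integral {A a : ℝ} (ha : 0 < a) (haA : a < A) (b : ℝ) {ρ : ℝ} (h0 : 0 ≤ ρ)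
    (h1 : ρ < 1) (n : ℕ) :
    testMoment A a b ρ n = Real.Gamma A / (Real.Gamma a * Real.Gamma (A - a)) *
      ∫ t in Set.Ioo (0 : ℝ) 1,
        t ^ (a + n - 1) * (1 - t) ^ (A - a - 1) * (ρ ^ n * (1 - ρ ^ 2 * t) ^ (-b)) := by
  set C := Real.Gamma A / (Real.Gamma a * Real.Gamma (A - a)) with hC
  have hC0 : 0 < C := div_pos (Real.Gamma_pos_of_pos (ha.trans haA))
    (mul_pos (Real.Gamma_pos_of_pos ha) (Real.Gamma_pos_of_pos (sub_pos.2 haA)))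
  let T : ℕ → ℝ → ℝ := fun k t =>
    (t ^ (a + (k + n : ℕ) - 1) * (1 - t) ^ (A - a - 1)) * (negBinom b k * ρ ^ (2 * k + n))
  have hI : ∀ m : ℕ, ∫ t in Set.Ioo (0 : ℝ) 1, t ^ (a + m - 1) * (1 - t) ^ (A - a - 1) =
      negBinom a m / negBinom A m / C := fun m => by
    rw [negBinom_ratio_eq_integral ha haA, ← hC, mul_div_cancel_left₀ _ hC0.ne']
  have hint : ∀ k, IntegrableOn (T k) (Set.Ioo 0 1) := fun k =>
    (integrableOn_beta (by positivity) (sub_pos.2 haA)).mul_const _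
  have hnorm : ∀ k, ∫ t in Set.Ioo (0 : ℝ) 1, ‖T k t‖ =
      negBinom a (k + n) / negBinom A (k + n) / C * (|negBinom b k| * ρ ^ (2 * k + n)) := by
    intro k
    rw [← hI, ← integral_mul_const]
    refine setIntegral_congr_fun measurableSet_Ioo fun t ht => ?_
    have ht0 := ht.1
    have ht1 : 0 < 1 - t := sub_pos.2 ht.2
    simp only [T, norm_mul, Real.norm_eq_abs]
    rw [abs_of_nonneg (by positivity : 0 ≤ t ^ (a + (k + n : ℕ) - 1)),
      abs_of_nonneg (by positivity : 0 ≤ (1 - t) ^ (A - a - 1)), abs_of_nonneg (pow_nonneg h0 _)]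
  have hsum : Summable fun k => ∫ t in Set.Ioo (0 : ℝ) 1, ‖T k t‖ := by
    simp only [hnorm]
    refine .of_nonneg_of_le (fun k => mul_nonneg (div_nonneg (div_nonneg (negBinom_pos ha _).le
      (negBinom_pos (ha.trans haA) _).le) hC0.le) (by positivity)) (fun k => ?_)
      (((summable_negBinom (a := b) (sq_nonneg ρ) (by nlinarith)).mul_right (ρ ^ n)).mul_left
        (1 / C))
    rw [← pow_mul, mul_assoc |_|, ← pow_add]
    gcongr
    exact div_le_one_of_le₀ (negBinom_mono ha.le haA.le _) (negBinom_pos (ha.trans haA) _).le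
  have h := hasSum_integral_of_summable_integral_norm hint hsum
  have e1 : ∫ t in Set.Ioo (0 : ℝ) 1, ∑' k, T k t = ∫ t in Set.Ioo (0 : ℝ) 1,
      t ^ (a + n - 1) * (1 - t) ^ (A - a - 1) * (ρ ^ n * (1 - ρ ^ 2 * t) ^ (-b)) := by
    refine setIntegral_congr_fun measurableSet_Ioo fun t ht => ?_
    have hx : |ρ ^ 2 * t| < 1 := by
      rw [abs_of_nonneg (mul_nonneg (sq_nonneg _) ht.1.le)]
      nlinarith [ht.1, ht.2, mul_le_of_le_one_left ht.1.le (by nlinarith : ρ ^ 2 ≤ 1)]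
    have hs := ((hasSum_negBinom_real b hx).mul_left
      (t ^ (a + n - 1) * (1 - t) ^ (A - a - 1) * ρ ^ n)).tsum_eq
    rw [← mul_assoc, ← hs]
    refine tsum_congr fun k => ?_
    have : t ^ (a + (k + n : ℕ) - 1) = t ^ (a + n - 1) * t ^ k := by
      rw [← Real.rpow_add_natCast ht.1.ne']; congr 1; push_cast; ring
    simp only [T]
    rw [this]
    ring
  rw [← e1, ← h.tsum_eq, ← tsum_mul_left, testMoment]
  refine tsum_congr fun k => ?_
  simp only [T]
  rw [integral_mul_const, hI]
  field_simp

theorem testMoment_nonneg {A a : ℝ} (ha : 0 < a) (haA : a < A) (b : ℝ) {ρ : ℝ} (h0 : 0 ≤ ρ)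
    (h1 : ρ < 1) (n : ℕ) : 0 ≤ testMoment A a b ρ n := by
  rw [testMoment_eq_integral ha haA b h0 h1]
  have g1 := Real.Gamma_pos_of_pos ha
  have g2 := Real.Gamma_pos_of_pos (ha.trans haA)
  have g3 := Real.Gamma_pos_of_pos (sub_pos.2 haA)
  refine mul_nonneg (by positivity) (setIntegral_nonneg measurableSet_Ioo fun t ht => ?_)
  have ht0 := ht.1
  have ht1 : 0 < 1 - t := sub_pos.2 ht.2
  have : 0 ≤ 1 - ρ ^ 2 * t := by nlinarith [mul_le_of_le_one_left ht0.le (by nlinarith : ρ ^ 2 ≤ 1)]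
  positivity

/-- Dominated convergence with (1 - ρ²t)^(-b) ≤ (1 - t)^(-|b|), integrable because |b| < A - a. The
limit is again a beta integral; this is Gauss's evaluation of a hypergeometric series at 1. -/
theorem tendsto_testMoment {A a b : ℝ} (ha : 0 < a) (haA : a < A) (hb : |b| < A - a) (n : ℕ) :
    Tendsto (fun ρ => testMoment A a b ρ n) (𝓝[<] 1)
      (𝓝 (Real.Gamma A * Real.Gamma (A - a - b) / (Real.Gamma (A - a) * Real.Gamma (A - b)) *
        (negBinom a n / negBinom (A - b) n))) := by
  have hb1 : b < A - a := (abs_lt.1 hb).2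
  have hev : ∀ᶠ ρ : ℝ in 𝓝[<] 1, ρ ∈ Set.Ioo (0 : ℝ) 1 := Ioo_mem_nhdsLT zero_lt_one
  have hlim : Tendsto (fun ρ : ℝ => ∫ t in Set.Ioo (0 : ℝ) 1,
        t ^ (a + n - 1) * (1 - t) ^ (A - a - 1) * (ρ ^ n * (1 - ρ ^ 2 * t) ^ (-b))) (𝓝[<] 1)
      (𝓝 (∫ t in Set.Ioo (0 : ℝ) 1, t ^ (a + n - 1) * (1 - t) ^ (A - a - b - 1))) := by
    refine tendsto_integral_filter_of_dominated_convergence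
      (fun t => t ^ (a + n - 1) * (1 - t) ^ (A - a - |b| - 1)) ?_ ?_
      (integrableOn_beta (by positivity) (by linarith)) ?_
    · exact Eventually.of_forall fun ρ => by fun_prop
    · filter_upwards [hev] with ρ hρ
      refine (ae_restrict_iff' measurableSet_Ioo).2 (ae_of_all _ fun t ht => ?_)
      have ht0 := ht.1
      have ht1 : 0 < 1 - t := sub_pos.2 ht.2
      have hρ2 : ρ ^ 2 ≤ 1 := by nlinarith [hρ.1, hρ.2]
      have hx : 1 - t ≤ 1 - ρ ^ 2 * t := by nlinarith [mul_le_of_le_one_left ht0.le hρ2]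
      have hx1 : 1 - ρ ^ 2 * t ≤ 1 := by nlinarith [mul_nonneg (sq_nonneg ρ) ht0.le]
      have hx0 : 0 < 1 - ρ ^ 2 * t := ht1.trans_le hx
      have hρ0 := hρ.1
      rw [Real.norm_of_nonneg (by positivity), sub_right_comm _ |b| 1,
        sub_eq_add_neg _ |b|, Real.rpow_add ht1, mul_assoc]
      gcongr
      calc ρ ^ n * (1 - ρ ^ 2 * t) ^ (-b) ≤ (1 - ρ ^ 2 * t) ^ (-b) :=
            mul_le_of_le_one_left (by positivity) (pow_le_one₀ hρ0.le hρ.2.le)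
        _ ≤ (1 - ρ ^ 2 * t) ^ (-|b|) :=
            Real.rpow_le_rpow_of_exponent_ge hx0 hx1 (neg_le_neg (le_abs_self b))
        _ ≤ (1 - t) ^ (-|b|) :=
            Real.rpow_le_rpow_of_nonpos ht1 hx (neg_nonpos.2 (abs_nonneg b))
    · refine (ae_restrict_iff' measurableSet_Ioo).2 (ae_of_all _ fun t ht => ?_)
      have ht1 : 0 < 1 - t := sub_pos.2 ht.2
      have hc : ContinuousAt (fun ρ : ℝ =>
          t ^ (a + n - 1) * (1 - t) ^ (A - a - 1) * (ρ ^ n * (1 - ρ ^ 2 * t) ^ (-b))) 1 := by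
        refine continuousAt_const.mul ((by fun_prop : ContinuousAt (fun ρ : ℝ => ρ ^ n) 1).mul
          (ContinuousAt.rpow_const (by fun_prop) (Or.inl ?_)))
        simpa using ht1.ne'
      have := hc.tendsto.mono_left (nhdsWithin_le_nhds (s := Set.Iio 1))
      simp only [one_pow, one_mul] at this
      rwa [mul_assoc, ← Real.rpow_add ht1, show A - a - 1 + -b = A - a - b - 1 by ring] at this
  have h2 := hlim.const_mul (Real.Gamma A / (Real.Gamma a * Real.Gamma (A - a)))
  have hAb : 0 < A - b := by linarith
  rw [integral_beta (by positivity) (by linarith), show a + n + (A - a - b) = A - b + n by ring,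
    Gamma_add_nat ha, Gamma_add_nat hAb] at h2
  refine (h2.congr' ?_).trans_eq ?_
  · filter_upwards [hev] with ρ hρ
    rw [testMoment_eq_integral ha haA b hρ.1.le hρ.2]
  · congr 1
    have g1 := Real.Gamma_pos_of_pos ha
    have g2 := Real.Gamma_pos_of_pos hAb
    have g3 := Real.Gamma_pos_of_pos (sub_pos.2 haA)
    have g4 := negBinom_pos hAb n
    field_simp

/-! ### The pairing of P f with g -/

theorem hasSum_bergmanProj_testFun {α : ℝ} (hα : -1 < α) (a b : ℝ) {ρ : ℝ} (h0 : 0 ≤ ρ)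
    (h1 : ρ < 1) {z : ℂ} (hz : z ∈ Metric.ball (0 : ℂ) 1) :
    HasSum (fun n => (negBinom (2 + α) n * testMoment (2 + α) a b ρ n : ℂ) * z ^ n)
      (bergmanProj α (testFun a b ρ) z) := by
  have := isProbabilityMeasure_diskMeasure hα
  have hz' : ‖z‖ < 1 := by simpa using hz
  obtain ⟨C, hC0, hC⟩ := exists_norm_testFun_le a b h0 h1
  let T : ℕ → ℂ → ℂ := fun n w =>
    (negBinom (2 + α) n * z ^ n) * (testFun a b ρ w * (starRingEnd ℂ) w ^ n)
  have hbd : ∀ n, ∀ᵐ w ∂(diskMeasure α), ‖T n w‖ ≤ |negBinom (2 + α) n| * ‖z‖ ^ n * C := by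
    intro n
    filter_upwards [ae_diskMeasure_mem_ball α] with w hw
    have hw' : ‖w‖ < 1 := by simpa using hw
    simp only [T, norm_mul, norm_pow, RCLike.norm_conj, Complex.norm_real, Real.norm_eq_abs]
    gcongr
    exact (mul_le_of_le_one_right (norm_nonneg _) (pow_le_one₀ (norm_nonneg _) hw'.le)).trans
      (hC w hw)
  have hint : ∀ n, Integrable (T n) (diskMeasure α) := fun n =>
    Integrable.of_bound (by
      have := measurable_testFun a b ρ
      exact Measurable.aestronglyMeasurable (by unfold T; fun_prop)) _ (hbd n)
  have h := hasSum_integral_of_summable_integral_norm hint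
    (.of_nonneg_of_le (fun _ => integral_nonneg fun _ => norm_nonneg _) (fun n => by
      simpa using integral_mono_ae (hint n).norm (integrable_const _) (hbd n))
      ((summable_negBinom (a := 2 + α) (norm_nonneg z) hz').mul_right C))
  have e : ∫ w, ∑' n, T n w ∂(diskMeasure α) = bergmanProj α (testFun a b ρ) z := by
    refine integral_congr_ae ?_
    filter_upwards [ae_diskMeasure_mem_ball α] with w hw
    have hw' : ‖w‖ < 1 := by simpa using hw
    have hs := hasSum_negBinom (2 + α) (z := z * (starRingEnd ℂ) w) (by
      rw [norm_mul, RCLike.norm_conj]; nlinarith [norm_nonneg z, norm_nonneg w])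
    rw [bergmanIntegrand, div_eq_mul_inv, ← Complex.cpow_neg, ← hs.tsum_eq, ← tsum_mul_left]
    refine tsum_congr fun n => ?_
    simp only [T, mul_pow]
    ring
  rw [e] at h
  refine h.congr_fun fun n => ?_
  simp only [T]
  rw [integral_const_mul, integral_testFun_mul_conj_pow hα a b h0 h1]
  ring

theorem hasSum_integral_bergmanProj_mul_conj {α : ℝ} (hα : -1 < α) {a : ℝ} (ha : 0 < a)
    (haA : a ≤ 2 + α) (b b' : ℝ) {ρ : ℝ} (h0 : 0 ≤ ρ) (h1 : ρ < 1) :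
    HasSum (fun n => ((negBinom (2 + α) n * testMoment (2 + α) a b ρ n *
      testMoment (2 + α) a b' ρ n : ℝ) : ℂ))
      (∫ z, bergmanProj α (testFun a b ρ) z * (starRingEnd ℂ) (testFun a b' ρ z)
        ∂(diskMeasure α)) := by
  have := isProbabilityMeasure_diskMeasure hα
  obtain ⟨C, hC0, hC⟩ := exists_norm_testFun_le a b' h0 h1
  let T : ℕ → ℂ → ℂ := fun n z => (negBinom (2 + α) n * testMoment (2 + α) a b ρ n : ℂ) *
    (z ^ n * (starRingEnd ℂ) (testFun a b' ρ z))
  set D := ∑' k, |negBinom b k| * (ρ ^ 2) ^ k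
  have hbd : ∀ n, ∀ᵐ z ∂(diskMeasure α), ‖T n z‖ ≤ |negBinom (2 + α) n| * ρ ^ n * (D * C) := by
    intro n
    filter_upwards [ae_diskMeasure_mem_ball α] with w hw
    have hw' : ‖w‖ < 1 := by simpa using hw
    simp only [T, norm_mul, norm_pow, RCLike.norm_conj, Complex.norm_real, Real.norm_eq_abs]
    have := abs_testMoment_le ha haA b h0 h1 n
    calc _ ≤ |negBinom (2 + α) n| * (D * ρ ^ n) * C := by
          refine mul_le_mul (mul_le_mul_of_nonneg_left this (abs_nonneg _)) ?_ (by positivity)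
            (mul_nonneg (abs_nonneg _) ((abs_nonneg _).trans this))
          exact (mul_le_of_le_one_left (norm_nonneg _) (pow_le_one₀ (norm_nonneg _) hw'.le)).trans
            (hC w hw)
      _ = _ := by ring
  have hint : ∀ n, Integrable (T n) (diskMeasure α) := fun n =>
    Integrable.of_bound (by
      have := measurable_testFun a b' ρ
      exact Measurable.aestronglyMeasurable (by unfold T; fun_prop)) _ (hbd n)
  have h := hasSum_integral_of_summable_integral_norm hint
    (.of_nonneg_of_le (fun _ => integral_nonneg fun _ => norm_nonneg _) (fun n => by
      simpa using integral_mono_ae (hint n).norm (integrable_const _) (hbd n))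
      ((summable_negBinom (a := 2 + α) h0 h1).mul_right (D * C)))
  have e : ∫ z, ∑' n, T n z ∂(diskMeasure α) = ∫ z, bergmanProj α (testFun a b ρ) z *
      (starRingEnd ℂ) (testFun a b' ρ z) ∂(diskMeasure α) := by
    refine integral_congr_ae ?_
    filter_upwards [ae_diskMeasure_mem_ball α] with z hz
    rw [← (hasSum_bergmanProj_testFun hα a b h0 h1 hz).tsum_eq, ← tsum_mul_right]
    refine tsum_congr fun n => ?_
    simp only [T]
    ring
  rw [e] at h
  refine h.congr_fun fun n => ?_
  have e2 : ∫ z, z ^ n * (starRingEnd ℂ) (testFun a b' ρ z) ∂(diskMeasure α) =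
      testMoment (2 + α) a b' ρ n := by
    rw [← Complex.conj_ofReal, ← integral_testFun_mul_conj_pow hα a b' h0 h1, ← integral_conj]
    refine integral_congr_ae (ae_of_all _ fun z => ?_)
    simp only [map_mul, map_pow, Complex.conj_conj]
    ring
  simp only [T]
  rw [integral_const_mul, e2]
  push_cast
  ring

/-- The relation between a, b and p makes |f|^p equal to |1-ρw|^(-2a), which is `testFun a a ρ`, a
nonnegative function. -/
theorem lintegral_norm_testFun_rpow {α : ℝ} (hα : -1 < α) {a b p : ℝ} (hp : 0 < p)
    (hab : (a + b) * p = 2 * a) {ρ : ℝ} (h0 : 0 ≤ ρ) (h1 : ρ < 1) :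
    ∫⁻ w, ‖testFun a b ρ w‖ₑ ^ p ∂(diskMeasure α) =
      ENNReal.ofReal (testMoment (2 + α) a a ρ 0) := by
  have h := integral_testFun_mul_conj_pow hα a a h0 h1 0
  have hint : Integrable (testFun a a ρ) (diskMeasure α) :=
    memLp_one_iff_integrable.1 (memLp_testFun hα a a h0 h1 1)
  have e1 : ∫ w, testFun a a ρ w * (starRingEnd ℂ) w ^ 0 ∂(diskMeasure α) =
      ((∫ w, ‖testFun a a ρ w‖ ∂(diskMeasure α) : ℝ) : ℂ) := by
    rw [← integral_complex_ofReal]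
    refine integral_congr_ae ?_
    filter_upwards with w
    rw [pow_zero, mul_one, testFun, Complex.mul_conj, Complex.norm_real, Complex.normSq_eq_norm_sq,
      Real.norm_of_nonneg (by positivity)]
  rw [e1, Complex.ofReal_inj] at h
  rw [← h, ofReal_integral_norm_eq_lintegral_enorm hint]
  refine lintegral_congr_ae ?_
  filter_upwards [ae_diskMeasure_mem_ball α] with w hw
  rw [← ofReal_norm, ← ofReal_norm, ENNReal.ofReal_rpow_of_nonneg (norm_nonneg _) hp.le,
    norm_testFun h0 h1 hw, norm_testFun h0 h1 hw, ← Real.rpow_mul (norm_nonneg _)]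
  congr 2
  linarith

theorem enorm_integral_mul_conj_le {X : Type*} [MeasurableSpace X] {μ : Measure X} {p q : ℝ}
    (hpq : p.HolderConjugate q) {F G : X → ℂ} (hF : AEStronglyMeasurable F μ)
    (hG : AEStronglyMeasurable G μ) :
    ‖∫ x, F x * (starRingEnd ℂ) (G x) ∂μ‖ₑ ≤
      eLpNorm F (ENNReal.ofReal p) μ * eLpNorm G (ENNReal.ofReal q) μ := by
  have hp := hpq.pos
  have hq := hpq.symm.pos
  rw [eLpNorm_eq_lintegral_rpow_enorm_toReal (by simpa using hp) ENNReal.ofReal_ne_top,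
    eLpNorm_eq_lintegral_rpow_enorm_toReal (by simpa using hq) ENNReal.ofReal_ne_top,
    ENNReal.toReal_ofReal hp.le, ENNReal.toReal_ofReal hq.le]
  refine (enorm_integral_le_lintegral_enorm _).trans
    (le_trans (le_of_eq ?_) (ENNReal.lintegral_mul_le_Lp_mul_Lq μ hpq hF.enorm hG.enorm))
  refine lintegral_congr fun x => ?_
  rw [enorm_mul, Pi.mul_apply, ← ofReal_norm ((starRingEnd ℂ) (G x)), RCLike.norm_conj, ofReal_norm]

/-- Hölder for ⟨P f, g⟩: the norms of f and g are N^(1/p) and N^(1/q) with the same N, so their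
product is N. Partial sums suffice since every term is nonnegative. -/
theorem sum_testMoment_le {α : ℝ} (hα : -1 < α) {p q a b B : ℝ} (hpq : p.HolderConjugate q)
    (hB0 : 0 ≤ B) (hB : bergmanNorm p α ≤ ENNReal.ofReal B) (ha : 0 < a) (haA : a < 2 + α)
    (hab : (a + b) * p = 2 * a) (hab' : (a - b) * q = 2 * a) {ρ : ℝ} (h0 : 0 ≤ ρ) (h1 : ρ < 1)
    (m : ℕ) :
    ∑ n ∈ Finset.range m, negBinom (2 + α) n * testMoment (2 + α) a b ρ n *
      testMoment (2 + α) a (-b) ρ n ≤ B * testMoment (2 + α) a a ρ 0 := by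
  have hp := hpq.pos
  have hq := hpq.symm.pos
  set N := testMoment (2 + α) a a ρ 0
  have hN : 0 ≤ N := testMoment_nonneg ha haA a h0 h1 0
  set I := ∫ z, bergmanProj α (testFun a b ρ) z * (starRingEnd ℂ) (testFun a (-b) ρ z)
    ∂(diskMeasure α)
  have hf := memLp_testFun hα a b h0 h1 (ENNReal.ofReal p)
  have hg := memLp_testFun hα a (-b) h0 h1 (ENNReal.ofReal q)
  have hI : ‖I‖ₑ ≤ ENNReal.ofReal (B * N) := by
    refine (enorm_integral_mul_conj_le hpq (aestronglyMeasurable_bergmanProj hα hf.1)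
      hg.1).trans ?_
    calc _ ≤ ENNReal.ofReal B * eLpNorm (testFun a b ρ) (ENNReal.ofReal p) (diskMeasure α) *
          eLpNorm (testFun a (-b) ρ) (ENNReal.ofReal q) (diskMeasure α) := by
          gcongr
          refine (eLpNorm_bergmanProj_le_bergmanNorm hp hf (testFun_ne_zero hα a b h0 h1)).trans ?_
          gcongr
      _ = _ := by
          rw [eLpNorm_eq_lintegral_rpow_enorm_toReal (by simpa using hp) ENNReal.ofReal_ne_top,
            eLpNorm_eq_lintegral_rpow_enorm_toReal (by simpa using hq) ENNReal.ofReal_ne_top,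
            ENNReal.toReal_ofReal hp.le, ENNReal.toReal_ofReal hq.le,
            lintegral_norm_testFun_rpow hα hp hab h0 h1,
            lintegral_norm_testFun_rpow hα hq (by rwa [← sub_eq_add_neg]) h0 h1, mul_assoc,
            ← ENNReal.rpow_add_of_nonneg _ _ (by positivity) (by positivity), one_div, one_div,
            hpq.inv_add_inv_eq_one, ENNReal.rpow_one, ENNReal.ofReal_mul hB0]
  have hs := hasSum_integral_bergmanProj_mul_conj hα ha haA.le b (-b) h0 h1
  have hre := Complex.hasSum_re hs
  simp only [Complex.ofReal_re] at hre
  refine (sum_le_hasSum _ (fun n _ => ?_) hre).trans ((Complex.re_le_norm _).trans ?_)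
  · exact mul_nonneg (mul_nonneg (negBinom_pos (by linarith) n).le
      (testMoment_nonneg ha haA b h0 h1 n)) (testMoment_nonneg ha haA (-b) h0 h1 n)
  · rwa [← ofReal_norm, ENNReal.ofReal_le_ofReal_iff (by positivity)] at hI

/-! ### Limits ρ → 1 and a → A/2, and the lower bound -/

/-- Limiting ratio between the terms of the pairing `⟨P f, g⟩` and those of `‖f‖ ‖g‖`. -/
noncomputable def pairingRatio (A a b : ℝ) (n : ℕ) : ℝ :=
  Real.Gamma A ^ 2 * (Real.Gamma (A - a - b) * Real.Gamma (A - a + b)) /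
    (Real.Gamma (A - a) ^ 2 * (Real.Gamma (A - b) * Real.Gamma (A + b))) *
    (negBinom A n ^ 2 / (negBinom (A - b) n * negBinom (A + b) n))

theorem pairingRatio_mono {A a b : ℝ} (ha : 0 < a) (hb : |b| < A - a) :
    Monotone (pairingRatio A a b) := by
  obtain ⟨hb1, hb2⟩ := abs_lt.1 hb
  have h0 := abs_nonneg b
  have g1 := Real.Gamma_pos_of_pos (s := A) (by linarith)
  have g2 := Real.Gamma_pos_of_pos (s := A - a - b) (by linarith)
  have g3 := Real.Gamma_pos_of_pos (s := A - a + b) (by linarith)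
  have g4 := Real.Gamma_pos_of_pos (s := A - a) (by linarith)
  have g5 := Real.Gamma_pos_of_pos (s := A - b) (by linarith)
  have g6 := Real.Gamma_pos_of_pos (s := A + b) (by linarith)
  exact (negBinom_ratio_mono (A := A) (b := b) (by linarith) (by linarith)).const_mul
    (by positivity)

theorem pairingRatio_nonneg {A a b : ℝ} (ha : 0 < a) (hb : |b| < A - a) (n : ℕ) :
    0 ≤ pairingRatio A a b n := by
  obtain ⟨hb1, hb2⟩ := abs_lt.1 hb
  have h0 := abs_nonneg b
  have g1 := Real.Gamma_pos_of_pos (s := A) (by linarith)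
  have g2 := Real.Gamma_pos_of_pos (s := A - a - b) (by linarith)
  have g3 := Real.Gamma_pos_of_pos (s := A - a + b) (by linarith)
  have g4 := Real.Gamma_pos_of_pos (s := A - a) (by linarith)
  have g5 := Real.Gamma_pos_of_pos (s := A - b) (by linarith)
  have g6 := Real.Gamma_pos_of_pos (s := A + b) (by linarith)
  have g7 := negBinom_pos (a := A - b) (by linarith) n
  have g8 := negBinom_pos (a := A + b) (by linarith) n
  unfold pairingRatio
  positivity

theorem tendsto_testMoment_mul {A a b : ℝ} (ha : 0 < a) (hb : |b| < A - a) (n : ℕ) :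
    Tendsto (fun ρ => negBinom A n * testMoment A a b ρ n * testMoment A a (-b) ρ n) (𝓝[<] 1)
      (𝓝 (negBinom a n ^ 2 / negBinom A n * pairingRatio A a b n)) := by
  have h0 := abs_nonneg b
  have h := ((tendsto_testMoment ha (by linarith) hb n).const_mul (negBinom A n)).mul
    (tendsto_testMoment ha (by linarith) (b := -b) (by rwa [abs_neg]) n)
  convert h using 2
  have := negBinom_pos (a := A) (by linarith) n
  simp only [pairingRatio, sub_neg_eq_add]
  field_simp

/-- Partial sums are limits as ρ → 1 of partial sums of the nonnegative series for the moment, and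
the moment has a finite limit because 2a < A. -/
theorem summable_negBinom_sq_div {A a : ℝ} (ha : 0 < a) (haA : a < A - a) :
    Summable (fun n => negBinom a n ^ 2 / negBinom A n) ∧
    ∀ ρ ∈ Set.Ioo (0 : ℝ) 1,
      testMoment A a a ρ 0 ≤ ∑' n, negBinom a n ^ 2 / negBinom A n := by
  have hA : 0 < A := by linarith
  have hx : ∀ n, 0 ≤ negBinom a n ^ 2 / negBinom A n := fun n =>
    div_nonneg (sq_nonneg _) (negBinom_pos hA n).le
  have hev : ∀ᶠ ρ : ℝ in 𝓝[<] 1, ρ ∈ Set.Ioo (0 : ℝ) 1 := Ioo_mem_nhdsLT zero_lt_one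
  have e : ∀ ρ, testMoment A a a ρ 0 = ∑' n, negBinom a n ^ 2 / negBinom A n * (ρ ^ 2) ^ n := by
    intro ρ
    refine tsum_congr fun n => ?_
    rw [add_zero, add_zero, pow_mul]
    ring
  have hsρ : ∀ ρ ∈ Set.Ioo (0 : ℝ) 1,
      Summable fun n => negBinom a n ^ 2 / negBinom A n * (ρ ^ 2) ^ n := fun ρ hρ => by
    refine .of_nonneg_of_le (fun n => mul_nonneg (hx n) (by positivity)) (fun n => ?_)
      (summable_negBinom (a := a) (sq_nonneg ρ) (by nlinarith [hρ.1, hρ.2]))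
    gcongr
    rw [abs_of_pos (negBinom_pos ha n), pow_two, mul_div_assoc]
    exact mul_le_of_le_one_right (negBinom_pos ha n).le
      (div_le_one_of_le₀ (negBinom_mono ha.le (by linarith) _) (negBinom_pos hA _).le)
  have hs : Summable (fun n => negBinom a n ^ 2 / negBinom A n) := by
    refine summable_of_sum_range_le (c := Real.Gamma A * Real.Gamma (A - a - a) /
      (Real.Gamma (A - a) * Real.Gamma (A - a)) * (negBinom a 0 / negBinom (A - a) 0)) hx
      fun m => ?_
    refine le_of_tendsto_of_tendsto (b := 𝓝[<] 1)
      (f := fun ρ : ℝ => ∑ n ∈ Finset.range m, negBinom a n ^ 2 / negBinom A n * (ρ ^ 2) ^ n)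
      ?_ (tendsto_testMoment ha (by linarith) (b := a) (by rwa [abs_of_pos ha]) 0) ?_
    · have : Continuous fun ρ : ℝ =>
          ∑ n ∈ Finset.range m, negBinom a n ^ 2 / negBinom A n * (ρ ^ 2) ^ n := by fun_prop
      simpa using (this.tendsto 1).mono_left (nhdsWithin_le_nhds (s := Set.Iio 1))
    · filter_upwards [hev] with ρ hρ
      rw [e]
      exact (hsρ ρ hρ).sum_le_tsum _ fun n _ => mul_nonneg (hx n) (by positivity)
  refine ⟨hs, fun ρ hρ => ?_⟩
  rw [e]
  refine (hsρ ρ hρ).tsum_le_tsum (fun n => ?_) hs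
  exact mul_le_of_le_one_right (hx n) (pow_le_one₀ (sq_nonneg _) (by nlinarith [hρ.1, hρ.2]))

theorem sum_pairingRatio_le {α : ℝ} (hα : -1 < α) {p q a b B : ℝ} (hpq : p.HolderConjugate q)
    (hB0 : 0 ≤ B) (hB : bergmanNorm p α ≤ ENNReal.ofReal B) (ha : 0 < a)
    (haA : a < 2 + α - a) (hb : |b| < 2 + α - a)
    (hab : (a + b) * p = 2 * a) (hab' : (a - b) * q = 2 * a) (m : ℕ) :
    ∑ n ∈ Finset.range m, negBinom a n ^ 2 / negBinom (2 + α) n * pairingRatio (2 + α) a b n ≤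
      B * ∑' n, negBinom a n ^ 2 / negBinom (2 + α) n := by
  refine le_of_tendsto (x := 𝓝[<] 1)
    (tendsto_finsetSum _ fun n _ => tendsto_testMoment_mul ha hb n) ?_
  have hev : ∀ᶠ ρ : ℝ in 𝓝[<] 1, ρ ∈ Set.Ioo (0 : ℝ) 1 := Ioo_mem_nhdsLT zero_lt_one
  filter_upwards [hev] with ρ hρ
  exact (sum_testMoment_le hα hpq hB0 hB ha (by linarith) hab hab' hρ.1.le hρ.2 m).trans
    (mul_le_mul_of_nonneg_left ((summable_negBinom_sq_div ha haA).2 ρ hρ) hB0)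

/-- Drop the terms below k and replace R_n by R_k in the rest. The right-hand side does not depend
on m, so divergence of ∑ x in a later limit forces R_k ≤ B. -/
theorem mul_sum_range_le_of_monotone {x R : ℕ → ℝ} {B : ℝ} (hx : ∀ n, 0 ≤ x n)
    (hR0 : ∀ n, 0 ≤ R n) (hR : Monotone R) (hs : Summable x)
    (h : ∀ m, ∑ n ∈ Finset.range m, x n * R n ≤ B * ∑' n, x n) (k m : ℕ) :
    (R k - B) * ∑ n ∈ Finset.range m, x n ≤ R k * ∑ n ∈ Finset.range k, x n := by
  have h1 : ∀ m ≥ k, R k * (∑ n ∈ Finset.range m, x n - ∑ n ∈ Finset.range k, x n) ≤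
      B * ∑' n, x n := fun m hm => by
    refine le_trans ?_ (h m)
    rw [← Finset.sum_Ico_eq_sub _ hm, Finset.mul_sum, ← Finset.sum_range_add_sum_Ico _ hm]
    refine le_add_of_nonneg_of_le (Finset.sum_nonneg fun n _ => mul_nonneg (hx n) (hR0 n)) ?_
    refine Finset.sum_le_sum fun n hn => ?_
    rw [mul_comm]
    exact mul_le_mul_of_nonneg_left (hR (Finset.mem_Ico.1 hn).1) (hx n)
  have h2 : R k * (∑' n, x n - ∑ n ∈ Finset.range k, x n) ≤ B * ∑' n, x n :=
    le_of_tendsto ((hs.hasSum.tendsto_sum_nat.sub_const _).const_mul _)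
      ((eventually_ge_atTop k).mono h1)
  have h3 : ∑ n ∈ Finset.range m, x n ≤ ∑' n, x n := hs.sum_le_tsum _ fun n _ => hx n
  have h4 : 0 ≤ ∑ n ∈ Finset.range k, x n := Finset.sum_nonneg fun n _ => hx n
  have h5 : 0 ≤ ∑ n ∈ Finset.range m, x n := Finset.sum_nonneg fun n _ => hx n
  rcases le_total B (R k) with hB | hB
  · nlinarith [mul_le_mul_of_nonneg_left h3 (sub_nonneg.2 hB)]
  · nlinarith [mul_nonneg (sub_nonneg.2 hB) h5, mul_nonneg (hR0 k) h4]

theorem tendsto_sum_negBinom_sq_div_atTop {A : ℝ} (hA : 0 < A) :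
    Tendsto (fun m => ∑ n ∈ Finset.range m, negBinom (A / 2) n ^ 2 / negBinom A n) atTop atTop := by
  -- Comparison with the harmonic series: the term of index 1 is A/4, and consecutive ratios are at
  -- least N/(N+1) because (A/2 + N)² ≥ N(A + N).
  have hx : ∀ n : ℕ, A / 4 * (1 / ((n : ℝ) + 1)) ≤
      negBinom (A / 2) (n + 1) ^ 2 / negBinom A (n + 1) := by
    intro n
    induction n with
    | zero =>
      rw [negBinom_succ, negBinom_succ, negBinom_zero, negBinom_zero]
      apply le_of_eq
      norm_num
      field_simp
      norm_num
    | succ n ih =>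
      have h1 := negBinom_pos hA (n + 1)
      have e : negBinom (A / 2) (n + 1 + 1) ^ 2 / negBinom A (n + 1 + 1) =
          negBinom (A / 2) (n + 1) ^ 2 / negBinom A (n + 1) *
            ((A / 2 + (n + 1)) ^ 2 / ((n + 1 + 1) * (A + (n + 1)))) := by
        rw [negBinom_succ _ (n + 1), negBinom_succ _ (n + 1)]
        push_cast
        field_simp
      rw [e]
      push_cast
      calc A / 4 * (1 / ((n : ℝ) + 1 + 1)) =
            A / 4 * (1 / ((n : ℝ) + 1)) * ((n + 1) / (n + 1 + 1)) := by field_simp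
        _ ≤ _ := by
            gcongr ?_ * ?_
            rw [div_le_div_iff₀ (by positivity) (by positivity)]
            nlinarith [sq_nonneg (A / 2), (by positivity : 0 < (n : ℝ) + 1 + 1)]
  rw [← tendsto_add_atTop_iff_nat 1]
  refine tendsto_atTop_mono (fun m => ?_)
    (Real.tendsto_sum_range_one_div_nat_succ_atTop.const_mul_atTop (by positivity : 0 < A / 4))
  rw [Finset.sum_range_succ', Finset.mul_sum]
  have : 0 ≤ negBinom (A / 2) 0 ^ 2 / negBinom A 0 := by simp [negBinom_zero]
  exact le_add_of_le_of_nonneg (Finset.sum_le_sum fun n _ => hx n) this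

theorem pairingRatio_le_of_bergmanNorm_le {α : ℝ} (hα : -1 < α) {p q B : ℝ}
    (hpq : p.HolderConjugate q) (hB0 : 0 ≤ B) (hB : bergmanNorm p α ≤ ENNReal.ofReal B) (k : ℕ) :
    pairingRatio (2 + α) ((2 + α) / 2) ((2 + α) / p - (2 + α) / 2) k ≤ B := by
  set A := 2 + α with hA
  have hA0 : 0 < A := by linarith
  have hp := hpq.pos
  have hq := hpq.symm.pos
  have hpi : 0 < p⁻¹ := by positivity
  have hp1 : p⁻¹ < 1 := inv_lt_one_of_one_lt₀ hpq.lt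
  have hev : ∀ᶠ σ : ℝ in 𝓝[<] A, σ ∈ Set.Ioo (0 : ℝ) A := Ioo_mem_nhdsLT hA0
  -- Here σ = 2a, and b = σ/p - σ/2 solves both exponent relations. Since ∑ x_n diverges at σ = A,
  -- the inequality is proved for σ < A with finite sums, passed to σ = A, and only then m → ∞.
  have key : ∀ m : ℕ, ∀ σ ∈ Set.Ioo (0 : ℝ) A,
      (pairingRatio A (σ / 2) (σ / p - σ / 2) k - B) *
        ∑ n ∈ Finset.range m, negBinom (σ / 2) n ^ 2 / negBinom A n ≤
      pairingRatio A (σ / 2) (σ / p - σ / 2) k *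
        ∑ n ∈ Finset.range k, negBinom (σ / 2) n ^ 2 / negBinom A n := by
    intro m σ ⟨h0, h1⟩
    have ha : 0 < σ / 2 := by linarith
    have haA : σ / 2 < A - σ / 2 := by linarith
    have hb : |σ / p - σ / 2| < A - σ / 2 := by
      rw [abs_lt, div_eq_mul_inv σ p]
      constructor <;> nlinarith
    refine mul_sum_range_le_of_monotone (fun n => div_nonneg (sq_nonneg _) (negBinom_pos hA0 n).le)
      (pairingRatio_nonneg ha hb) (pairingRatio_mono ha hb) (summable_negBinom_sq_div ha haA).1
      (sum_pairingRatio_le hα hpq hB0 hB ha haA hb ?_ ?_) k m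
    · field_simp; ring
    · have : σ / p = σ - σ / q := by
        rw [div_eq_mul_inv, div_eq_mul_inv, ← hpq.one_sub_inv]; ring
      rw [this]
      field_simp
      ring
  have hG : ∀ {f : ℝ → ℝ}, Continuous f → 0 < f A → ContinuousAt (fun σ => Real.Gamma (f σ)) A :=
    fun hf h0 => (continuousAt_Gamma_of_pos h0).comp hf.continuousAt
  have hN : ∀ {f : ℝ → ℝ}, Continuous f → ContinuousAt (fun σ => negBinom (f σ) k) A :=
    fun hf => ((continuous_negBinom k).comp hf).continuousAt
  have hpA : 0 < A / p := div_pos hA0 hp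
  have hpA' : A / p < A := by rw [div_eq_mul_inv]; nlinarith
  have hRc : ContinuousAt (fun σ => pairingRatio A (σ / 2) (σ / p - σ / 2) k) A := by
    unfold pairingRatio
    have g1 := Real.Gamma_pos_of_pos (s := A - A / 2) (by linarith)
    have g2 := Real.Gamma_pos_of_pos (s := A - (A / p - A / 2)) (by linarith)
    have g3 := Real.Gamma_pos_of_pos (s := A + (A / p - A / 2)) (by linarith)
    have g4 := negBinom_pos (a := A - (A / p - A / 2)) (by linarith) k
    have g5 := negBinom_pos (a := A + (A / p - A / 2)) (by linarith) k
    refine (ContinuousAt.div (continuousAt_const.mul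
      ((hG (by fun_prop) (by linarith)).mul (hG (by fun_prop) (by linarith))))
      (((hG (by fun_prop) (by linarith)).pow 2).mul
        ((hG (by fun_prop) (by linarith)).mul (hG (by fun_prop) (by linarith)))) ?_).mul
      (continuousAt_const.div ((hN (by fun_prop)).mul (hN (by fun_prop))) ?_)
    · exact mul_ne_zero (pow_ne_zero _ g1.ne') (mul_ne_zero g2.ne' g3.ne')
    · exact mul_ne_zero g4.ne' g5.ne'
  have hTc : ∀ m, ContinuousAt
      (fun σ => ∑ n ∈ Finset.range m, negBinom (σ / 2) n ^ 2 / negBinom A n) A := fun m => by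
    refine Continuous.continuousAt (continuous_finsetSum _ fun n _ => ?_)
    exact (((continuous_negBinom n).comp (continuous_id.div_const 2)).pow 2).div_const _
  have hlim : ∀ m : ℕ, (pairingRatio A (A / 2) (A / p - A / 2) k - B) *
        ∑ n ∈ Finset.range m, negBinom (A / 2) n ^ 2 / negBinom A n ≤
      pairingRatio A (A / 2) (A / p - A / 2) k *
        ∑ n ∈ Finset.range k, negBinom (A / 2) n ^ 2 / negBinom A n := fun m =>
    le_of_tendsto_of_tendsto (b := 𝓝[<] A)
      (((hRc.sub continuousAt_const).mul (hTc m)).tendsto.mono_left nhdsWithin_le_nhds)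
      ((hRc.mul (hTc k)).tendsto.mono_left nhdsWithin_le_nhds) (hev.mono (key m))
  by_contra! hlt
  obtain ⟨m, hm⟩ := (((tendsto_sum_negBinom_sq_div_atTop hA0).const_mul_atTop
    (sub_pos.2 hlt)).eventually_gt_atTop _).exists
  exact (hlim m).not_gt hm

theorem le_bergmanNorm {p q α : ℝ} (hpq : p.HolderConjugate q) (hα : -1 < α) :
    ENNReal.ofReal (Real.Gamma ((2 + α) / p) * Real.Gamma ((2 + α) / q) /
      Real.Gamma ((2 + α) / 2) ^ 2) ≤ bergmanNorm p α := by
  -- Finiteness comes from the upper bound; it allows the norm itself to serve as the real constant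
  -- B.
  have hfin : bergmanNorm p α ≠ ⊤ :=
    ((bergmanNorm_le hpq hα).trans_lt ENNReal.ofReal_lt_top).ne
  rw [← ENNReal.ofReal_toReal hfin]
  refine ENNReal.ofReal_le_ofReal ?_
  have hle := pairingRatio_le_of_bergmanNorm_le hα hpq ENNReal.toReal_nonneg
    (ENNReal.ofReal_toReal hfin).ge
  set A := 2 + α
  have hA0 : 0 < A := by simp only [A]; linarith
  have hpi : 0 < p⁻¹ := inv_pos.2 hpq.pos
  have hp1 : p⁻¹ < 1 := inv_lt_one_of_one_lt₀ hpq.lt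
  set b := A / p - A / 2 with hb
  have hpA : 0 < A / p := div_pos hA0 hpq.pos
  have hpA' : A / p < A := by rw [div_eq_mul_inv]; nlinarith
  have hbA : |b| < A := by rw [abs_lt]; constructor <;> linarith
  refine le_of_tendsto ((tendsto_negBinom_ratio hA0 hbA).const_mul
    (Real.Gamma A ^ 2 * (Real.Gamma (A - A / 2 - b) * Real.Gamma (A - A / 2 + b)) /
    (Real.Gamma (A - A / 2) ^ 2 * (Real.Gamma (A - b) * Real.Gamma (A + b))))
    |>.trans_eq ?_) (Eventually.of_forall hle)
  congr 1
  have e1 : A - A / 2 - b = A / q := by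
    rw [hb, div_eq_mul_inv A q, ← hpq.one_sub_inv]; ring
  have e2 : A - A / 2 + b = A / p := by rw [hb]; ring
  have g1 := Real.Gamma_pos_of_pos (s := A - b) (by linarith)
  have g2 := Real.Gamma_pos_of_pos (s := A + b) (by linarith)
  have g3 := Real.Gamma_pos_of_pos hA0
  rw [e1, e2, sub_half]
  field_simp

theorem theorem1 (p q : ℝ) (hp : 1 < p) (hq : q = p / (p - 1)) :
    (∀ α : ℝ, -1 < α →
      (∀ f : ℂ → ℂ, MemLp f (ENNReal.ofReal p) (diskMeasure α) →
        (∀ z ∈ Metric.ball (0 : ℂ) 1,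
          Integrable (bergmanIntegrand α f z) (diskMeasure α)) ∧
        MemLp (bergmanProj α f) (ENNReal.ofReal p) (diskMeasure α)) ∧
      ENNReal.ofReal (Real.Gamma ((2 + α) / p) * Real.Gamma ((2 + α) / q) /
          Real.Gamma ((2 + α) / 2) ^ 2) ≤ bergmanNorm p α ∧
      bergmanNorm p α ≤ ENNReal.ofReal ((1 + α) *
          (Real.Gamma ((1 + α) / p) * Real.Gamma ((1 + α) / q) /
            Real.Gamma ((2 + α) / 2) ^ 2))) ∧
    Tendsto (fun α : ℝ => Real.Gamma ((2 + α) / p) * Real.Gamma ((2 + α) / q) /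
          Real.Gamma ((2 + α) / 2) ^ 2)
      (𝓝[>] (-1)) (𝓝 (1 / Real.sin (Real.pi / p))) := by
  have hpq : p.HolderConjugate q := (Real.holderConjugate_iff_eq_conjExponent hp).2 hq
  refine ⟨fun α hα => ⟨fun f hf => ⟨fun z hz => ?_, memLp_bergmanProj hpq hα hf⟩,
    le_bergmanNorm hpq hα, bergmanNorm_le hpq hα⟩, tendsto_lower_bound hpq⟩
  have := isProbabilityMeasure_diskMeasure hα
  -- On a probability space L^p is contained in L^1.
  exact integrable_bergmanIntegrand hα (hf.integrable (by simpa using hp.le)) hz
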